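/- Let $\Omega\subset\mathbf R^n$ be a bounded open set with smooth boundary $S=\partial\Omega$ (a compact smooth hypersurface), let $\vec n$ be its outward unit normal and $\Pi=\nabla\vec n$ its shape operator (the tangential derivative of $\vec n$). Let $g_1,g_2:S\to(0,\infty)$ be smooth, and let $v:S\to\mathbf R^n$ be a smooth tangent vector field on $S$, not identically zero, which is a Killing field, i.e. $\partial_\tau v(x)\cdot\tau=0$ for all $x\in S$ and $\tau\in T_xS$, and which satisfies $v\cdot\nabla(g_1+g_2)=0$ on $S$ (tangential gradient). For $h>0$ put $$S^h=\{x+t\vec n(x):\ x\in S,\ -hg_1(x)<t<hg_2(x)\},$$ $$v^h(x+t\vec n(x))=\big(\mathrm{Id}+t\,\Pi(x)+h\,\vec n(x)\otimes\nabla g_2(x)\big)v(x)\qquad(x\in S,\ -hg_1(x)\le t\le hg_2(x)),$$ where $(a\otimes b)v=(b\cdot v)\,a$. For a vector field $u$ write $D(u)=\frac12(\nabla u+(\nabla u)^T)$. Then there are constants $h_0,C,c,\kappa>0$, independent of $h$, such that for every $0<h<h_0$ the following hold. 1. $S^h$ is an open set with smooth boundary $\{x-hg_1(x)\vec n(x):x\in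 S\}\cup\{x+hg_2(x)\vec n(x):x\in S\}$, with outward unit normal denoted $\vec n^h$. The field $v^h$ is well defined on $\overline{S^h}$, belongs to $W^{1,2}(S^h,\mathbf R^n)$, and is tangent to the boundary: $v^h\cdot\vec n^h=0$ on $\partial S^h$ (pointwise and in the sense of traces). 2. $\|D(v^h)\|^2_{L^2(S^h)}\le Ch^3$ and $\|\nabla v^h\|^2_{L^2(S^h)}\ge ch$. 3. If $K\in\mathbf R$ is such that $\|u\|_{W^{1,2}(S^h)}\le K\|D(u)\|_{L^2(S^h)}$ for all $u\in W^{1,2}(S^h,\mathbf R^n)$ with $u\cdot\vec n^h=0$ on $\partial S^h$, then $K\ge\kappa/h$. In particular no constant independent of $h$ is admissible. 4. Suppose that $S$ has no rotational symmetry, i.e. every field $w(z)=Az+b$ with $A$ skew-symmetric, $b\in\mathbf R^n$ and $w\cdot\vec n=0$ on $S$ vanishes on $S$. If $K_h\in\mathbf R$ is such that $\|u\|_{W^{1,2}(S^h)}\le K_h\|D(u)\|_{L^2(S^h)}$ for all $u\in W^{1,2}(S^h,\mathbf R^n)$ with $u\cdot\vec n^h=0$ on $\partial S^h$ which are $L^2(S^h)$-orthogonal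 to all fields $w(z)=Az+b$ with $A$ skew-symmetric and $w\cdot\vec n^h=0$ on $\partial S^h$, then $K_h\ge\kappa/h$. So these Korn constants tend to infinity as $h\to0$ even without rotational symmetry. -/

import Mathlib

open Set Filter Topology MeasureTheory
open scoped ContDiff RealInnerProductSpace

/-- Euclidean space `ℝⁿ`. -/
abbrev Rn (n : ℕ) : Type := EuclideanSpace ℝ (Fin n)

/-! ### Smooth domains, normals, smooth functions on a hypersurface -/

/-- `ν` is the outward unit normal at `z` to the open set `U`: near `z` the set `U` is `{ρ < 0}` for
a smooth `ρ` with nonzero gradient at `z`, and `ν = ∇ρ(z) / |∇ρ(z)|`. For `z ∈ ∂U` such a `ν` is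
unique. -/
def IsOuterNormal {n : ℕ} (U : Set (Rn n)) (z ν : Rn n) : Prop :=
  ∃ ρ : Rn n → ℝ, ContDiff ℝ ∞ ρ ∧ gradient ρ z ≠ 0 ∧
    (∀ᶠ y in 𝓝 z, y ∈ U ↔ ρ y < 0) ∧ ν = ‖gradient ρ z‖⁻¹ • gradient ρ z

/-- `U` is open and its boundary is a smooth hypersurface with `U` locally on one side of it. -/
def HasSmoothBoundary {n : ℕ} (U : Set (Rn n)) : Prop :=
  IsOpen U ∧ ∀ z ∈ frontier U, ∃ ν, IsOuterNormal U z ν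

open Classical in
/-- The outward unit normal of `U` (used only at points of the boundary of a smooth `U`). -/
noncomputable def outerNormal {n : ℕ} (U : Set (Rn n)) (z : Rn n) : Rn n :=
  if hz : ∃ ν, IsOuterNormal U z ν then hz.choose else 0

/-- Smoothness of a function on a closed hypersurface `S`: it is the restriction to `S` of a smooth
function on `ℝⁿ`. -/
def IsSmoothOn {n : ℕ} {F : Type*} [NormedAddCommGroup F] [NormedSpace ℝ F]
    (S : Set (Rn n)) (f : Rn n → F) : Prop :=
  ∃ f' : Rn n → F, ContDiff ℝ ∞ f' ∧ EqOn f f' S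

/-- `τ` belongs to the tangent space at `x` of `S = ∂Ω`. -/
def IsTangent {n : ℕ} (Ω : Set (Rn n)) (x τ : Rn n) : Prop :=
  ⟪τ, outerNormal Ω x⟫ = 0

/-- The derivative at `x ∈ S = ∂Ω`, in the tangent direction `τ`, of a function given on `S`.
It depends only on the values of `f` on `S`; derivatives within `S` agree on tangent vectors, and
it is only used for tangent `τ`. -/
noncomputable def surfDeriv {n : ℕ} {F : Type*} [NormedAddCommGroup F] [NormedSpace ℝ F]
    (Ω : Set (Rn n)) (f : Rn n → F) (x τ : Rn n) : F :=
  fderivWithin ℝ f (frontier Ω) x τ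

/-- The tangential gradient on `S = ∂Ω` of a scalar function: the tangential component of a gradient
within `S`. -/
noncomputable def surfGrad {n : ℕ} (Ω : Set (Rn n)) (g : Rn n → ℝ) (x : Rn n) : Rn n :=
  gradientWithin g (frontier Ω) x
    - ⟪gradientWithin g (frontier Ω) x, outerNormal Ω x⟫ • outerNormal Ω x

/-! ### Killing fields, thin shells, the extension -/

/-- `v` is a smooth Killing field on `S = ∂Ω`: smooth, tangent, and `∂_τ v · τ = 0` for every
tangent `τ`. -/
def IsKilling {n : ℕ} (Ω : Set (Rn n)) (v : Rn n → Rn n) : Prop :=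
  IsSmoothOn (frontier Ω) v ∧
  (∀ x ∈ frontier Ω, IsTangent Ω x (v x)) ∧
  ∀ x ∈ frontier Ω, ∀ τ, IsTangent Ω x τ → ⟪surfDeriv Ω v x τ, τ⟫ = 0

/-- The shell `{x + t n(x) : x ∈ S, -a(x) < t < b(x)}` around `S = ∂Ω`. -/
def shell {n : ℕ} (Ω : Set (Rn n)) (a b : Rn n → ℝ) : Set (Rn n) :=
  {z | ∃ x ∈ frontier Ω, ∃ t : ℝ, -a x < t ∧ t < b x ∧ z = x + t • outerNormal Ω x}

/-- Normal coordinates: a pair `(x, t)` with `x ∈ S`, `-a(x) ≤ t ≤ b(x)` and `x + t n(x) = z`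
(for thin shells this pair is unique, and `x` is the projection of `z` on `S` along `n`). -/
noncomputable def normalCoord {n : ℕ} (Ω : Set (Rn n)) (a b : Rn n → ℝ) : Rn n → Rn n × ℝ :=
  Function.invFunOn (fun p : Rn n × ℝ => p.1 + p.2 • outerNormal Ω p.1)
    {p | p.1 ∈ frontier Ω ∧ -a p.1 ≤ p.2 ∧ p.2 ≤ b p.1}

/-- `(Id + t Π(x) + h n(x) ⊗ ∇g₂(x)) v(x)`, where `Π = ∇n` is the shape operator of `S = ∂Ω`. -/
noncomputable def extValue {n : ℕ} (Ω : Set (Rn n)) (g₂ : Rn n → ℝ) (v : Rn n → Rn n)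
    (h : ℝ) (x : Rn n) (t : ℝ) : Rn n :=
  v x + t • surfDeriv Ω (outerNormal Ω) x (v x)
    + (h * ⟪surfGrad Ω g₂ x, v x⟫) • outerNormal Ω x

/-- The extension `vʰ` of `v` to the closed shell `-h g₁(x) ≤ t ≤ h g₂(x)`, given by
`vʰ(x + t n(x)) = (Id + t Π(x) + h n(x) ⊗ ∇g₂(x)) v(x)`. -/
noncomputable def killingExt {n : ℕ} (Ω : Set (Rn n)) (g₁ g₂ : Rn n → ℝ) (v : Rn n → Rn n)
    (h : ℝ) (z : Rn n) : Rn n :=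
  let p := normalCoord Ω (fun x => h * g₁ x) (fun x => h * g₂ x) z
  extValue Ω g₂ v h p.1 p.2

/-! ### The Sobolev space `W^{1,2}(U, ℝⁿ)`, norms, boundary condition -/

/-- The partial derivative in the `j`-th coordinate direction. -/
noncomputable def partialDeriv {n : ℕ} {F : Type*} [NormedAddCommGroup F] [NormedSpace ℝ F]
    (j : Fin n) (f : Rn n → F) (x : Rn n) : F :=
  fderiv ℝ f x (EuclideanSpace.single j 1)

/-- `u ∈ W^{1,2}(U, ℝⁿ)` with weak gradient `G`, `G i j = ∂_j u_i`. -/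
def HasW12Grad {n : ℕ} (U : Set (Rn n)) (u : Rn n → Rn n)
    (G : Rn n → Matrix (Fin n) (Fin n) ℝ) : Prop :=
  MemLp u 2 (volume.restrict U) ∧
  (∀ i j, MemLp (fun x => G x i j) 2 (volume.restrict U)) ∧
  ∀ φ : Rn n → ℝ, ContDiff ℝ ∞ φ → HasCompactSupport φ → tsupport φ ⊆ U →
    ∀ i j, ∫ x in U, u x i * partialDeriv j φ x = -∫ x in U, G x i j * φ x

/-- The square of the Frobenius norm of a matrix. -/
def frobSq {n : ℕ} (M : Matrix (Fin n) (Fin n) ℝ) : ℝ := ∑ i, ∑ j, M i j ^ 2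

/-- The symmetric part of a matrix. -/
noncomputable def symPart {n : ℕ} (M : Matrix (Fin n) (Fin n) ℝ) : Matrix (Fin n) (Fin n) ℝ :=
  (1 / 2 : ℝ) • (M + M.transpose)

/-- `‖G‖²_{L²(U)}` for a matrix field. -/
noncomputable def l2Sq {n : ℕ} (U : Set (Rn n)) (G : Rn n → Matrix (Fin n) (Fin n) ℝ) : ℝ :=
  ∫ x in U, frobSq (G x)

/-- `‖D(u)‖²_{L²(U)}` in terms of the gradient `G` of `u`. -/
noncomputable def symL2Sq {n : ℕ} (U : Set (Rn n)) (G : Rn n → Matrix (Fin n) (Fin n) ℝ) : ℝ :=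
  l2Sq U (fun x => symPart (G x))

/-- `‖u‖²_{W^{1,2}(U)}` in terms of `u` and its gradient `G`. -/
noncomputable def w12Sq {n : ℕ} (U : Set (Rn n)) (u : Rn n → Rn n)
    (G : Rn n → Matrix (Fin n) (Fin n) ℝ) : ℝ :=
  (∫ x in U, ‖u x‖ ^ 2) + l2Sq U G

/-- `u · n = 0` on `∂U` in the sense of traces, for `u ∈ W^{1,2}(U, ℝⁿ)` with gradient `G`: some
smooth fields `uₖ` on `ℝⁿ` converge to `u` in `W^{1,2}(U)` and the boundary values `uₖ · n`, which
converge to the normal trace of `u`, tend to `0` in `L²(∂U)` (surface measure). -/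
def HasZeroNormalTrace {n : ℕ} (U : Set (Rn n)) (u : Rn n → Rn n)
    (G : Rn n → Matrix (Fin n) (Fin n) ℝ) : Prop :=
  ∃ w : ℕ → Rn n → Rn n, (∀ k, ContDiff ℝ ∞ (w k)) ∧
    Tendsto (fun k => eLpNorm (fun x => w k x - u x) 2 (volume.restrict U)) atTop (𝓝 0) ∧
    (∀ i j, Tendsto (fun k => eLpNorm (fun x => partialDeriv j (w k) x i - G x i j) 2
      (volume.restrict U)) atTop (𝓝 0)) ∧
    Tendsto (fun k => eLpNorm (fun z => ⟪w k z, outerNormal U z⟫) 2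
      ((Measure.hausdorffMeasure ((n : ℝ) - 1)).restrict (frontier U))) atTop (𝓝 0)

/-! ### Rigid motions and Korn constants -/

/-- `w(z) = A z + b` with `A` skew-symmetric, and `w` is tangent to `∂U`. -/
def IsTangentRigid {n : ℕ} (U : Set (Rn n)) (w : Rn n → Rn n) : Prop :=
  (∃ (A : Rn n →L[ℝ] Rn n) (b : Rn n), (∀ z, ⟪A z, z⟫ = 0) ∧ ∀ z, w z = A z + b) ∧
  ∀ z ∈ frontier U, ⟪w z, outerNormal U z⟫ = 0

/-- `S = ∂Ω` has no rotational symmetry: the only field on `S` that is tangent to `S` and is the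
restriction of an infinitesimal rigid motion of `ℝⁿ` is `0`. -/
def NoRotationalSymmetry {n : ℕ} (Ω : Set (Rn n)) : Prop :=
  ∀ w, IsTangentRigid Ω w → ∀ x ∈ frontier Ω, w x = 0

/-- `‖u‖_{W^{1,2}(U)} ≤ K ‖D(u)‖_{L²(U)}` for all `u ∈ W^{1,2}(U, ℝⁿ)` with `u · n = 0` on `∂U`. -/
def IsKornConst {n : ℕ} (U : Set (Rn n)) (K : ℝ) : Prop :=
  ∀ (u : Rn n → Rn n) (G : Rn n → Matrix (Fin n) (Fin n) ℝ),
    HasW12Grad U u G → HasZeroNormalTrace U u G → √(w12Sq U u G) ≤ K * √(symL2Sq U G)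

/-- `‖u‖_{W^{1,2}(U)} ≤ K ‖D(u)‖_{L²(U)}` for all `u ∈ W^{1,2}(U, ℝⁿ)` with `u · n = 0` on `∂U` that
are `L²(U)`-orthogonal to the infinitesimal rigid motions tangent to `∂U`. -/
def IsKornConstModRigid {n : ℕ} (U : Set (Rn n)) (K : ℝ) : Prop :=
  ∀ (u : Rn n → Rn n) (G : Rn n → Matrix (Fin n) (Fin n) ℝ),
    HasW12Grad U u G → HasZeroNormalTrace U u G →
    (∀ w, IsTangentRigid U w → ∫ z in U, ⟪u z, w z⟫ = 0) →
    √(w12Sq U u G) ≤ K * √(symL2Sq U G)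

variable {n : ℕ}

/-! ### Outer normals and defining functions -/

theorem eventually_pos_of_hasDerivAt {f : ℝ → ℝ} {f' : ℝ} (hf : HasDerivAt f f' 0)
    (h0 : f 0 = 0) (hf' : 0 < f') : ∀ᶠ t in 𝓝[>] (0 : ℝ), 0 < f t := by
  have h1 := (hasDerivAt_iff_tendsto_slope.1 hf).eventually (lt_mem_nhds hf')
  have h2 : ∀ᶠ t in 𝓝[>] (0 : ℝ), 0 < slope f 0 t :=
    h1.filter_mono (nhdsWithin_mono _ fun t (ht : 0 < t) => ht.ne')
  filter_upwards [h2, self_mem_nhdsWithin] with t ht (ht0 : 0 < t)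
  rw [slope_def_field, h0, sub_zero, sub_zero] at ht
  exact (div_pos_iff_of_pos_right ht0).1 ht

theorem hasDerivAt_line {E F : Type*} [NormedAddCommGroup E] [NormedSpace ℝ E]
    [NormedAddCommGroup F] [NormedSpace ℝ F] {f : E → F} {z w : E} {t : ℝ}
    (hf : DifferentiableAt ℝ f (z + t • w)) :
    HasDerivAt (fun s : ℝ => f (z + s • w)) (fderiv ℝ f (z + t • w) w) t := by
  have h : HasDerivAt (fun s : ℝ => z + s • w) w t := by
    simpa using ((hasDerivAt_id t).smul_const w).const_add z
  exact hf.hasFDerivAt.comp_hasDerivAt t h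

theorem eventually_pos_line {ρ : Rn n → ℝ} {z w : Rn n} (hρ : DifferentiableAt ℝ ρ z)
    (h0 : ρ z = 0) (hw : 0 < ⟪gradient ρ z, w⟫) :
    ∀ᶠ t in 𝓝[>] (0 : ℝ), 0 < ρ (z + t • w) := by
  have hz : z + (0 : ℝ) • w = z := by simp
  have h := hasDerivAt_line (f := ρ) (z := z) (w := w) (t := 0) (by rwa [hz])
  rw [hz, ← inner_gradient_left] at h
  exact eventually_pos_of_hasDerivAt h (by simpa using h0) hw

theorem eventually_neg_line {ρ : Rn n → ℝ} {z w : Rn n} (hρ : DifferentiableAt ℝ ρ z)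
    (h0 : ρ z = 0) (hw : ⟪gradient ρ z, w⟫ < 0) :
    ∀ᶠ t in 𝓝[>] (0 : ℝ), ρ (z + t • w) < 0 := by
  have hz : z + (0 : ℝ) • w = z := by simp
  have h := (hasDerivAt_line (f := ρ) (z := z) (w := w) (t := 0) (by rwa [hz])).neg
  rw [hz, ← inner_gradient_left] at h
  filter_upwards [eventually_pos_of_hasDerivAt h (by simpa using h0) (neg_pos.2 hw)] with t ht
  simpa using ht

theorem tendsto_line (z w : Rn n) :
    Tendsto (fun t : ℝ => z + t • w) (𝓝[>] (0 : ℝ)) (𝓝 z) := by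
  have : Tendsto (fun t : ℝ => z + t • w) (𝓝 (0 : ℝ)) (𝓝 (z + (0 : ℝ) • w)) :=
    (by fun_prop : Continuous fun t : ℝ => z + t • w).tendsto 0
  simpa using this.mono_left nhdsWithin_le_nhds

theorem eq_zero_of_mem_frontier {U : Set (Rn n)} {ρ : Rn n → ℝ} {z : Rn n}
    (hρ : ContinuousAt ρ z) (h₁ : ∀ᶠ y in 𝓝 z, y ∈ U → ρ y ≤ 0)
    (h₂ : ∀ᶠ y in 𝓝 z, y ∉ U → 0 ≤ ρ y) (hz : z ∈ frontier U) : ρ z = 0 := by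
  rw [frontier_eq_closure_inter_closure] at hz
  apply le_antisymm
  · have := mem_closure_iff_nhdsWithin_neBot.1 hz.1
    exact le_of_tendsto (hρ.mono_left nhdsWithin_le_nhds)
      (eventually_nhdsWithin_iff.2 h₁)
  · have : (𝓝[Uᶜ] z).NeBot := mem_closure_iff_nhdsWithin_neBot.1 hz.2
    exact ge_of_tendsto (hρ.mono_left nhdsWithin_le_nhds)
      (eventually_nhdsWithin_iff (s := Uᶜ).2 h₂)

theorem eq_zero_of_sign {U : Set (Rn n)} {ρ : Rn n → ℝ} {z : Rn n}
    (hρ : ContinuousAt ρ z) (h : ∀ᶠ y in 𝓝 z, y ∈ U ↔ ρ y < 0) (hz : z ∈ frontier U) :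
    ρ z = 0 := by
  refine eq_zero_of_mem_frontier hρ ?_ ?_ hz
  · filter_upwards [h] with y hy hyU using (hy.1 hyU).le
  · filter_upwards [h] with y hy hyU using not_lt.1 fun h => hyU (hy.2 h)

theorem norm_outer_normal {U : Set (Rn n)} {z ν : Rn n} (h : IsOuterNormal U z ν) : ‖ν‖ = 1 := by
  obtain ⟨ρ, -, h0, -, rfl⟩ := h
  rw [norm_smul, norm_inv, norm_norm, inv_mul_cancel₀ (norm_ne_zero_iff.2 h0)]

/-- If two unit normals differed, the direction `ν₂ - ν₁` would point strictly inward for the first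
defining function and strictly outward for the second, so nearby points on that ray would be both
inside and outside `U`. -/
theorem IsOuterNormal.unique {U : Set (Rn n)} {z ν₁ ν₂ : Rn n} (hz : z ∈ frontier U)
    (h₁ : IsOuterNormal U z ν₁) (h₂ : IsOuterNormal U z ν₂) : ν₁ = ν₂ := by
  have n₁ := norm_outer_normal h₁
  have n₂ := norm_outer_normal h₂
  by_contra hne
  have hlt : ⟪ν₁, ν₂⟫ < 1 := (inner_lt_one_iff_real_of_norm_eq_one n₁ n₂).2 hne
  obtain ⟨ρ₁, s₁, g₁, U₁, e₁⟩ := h₁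
  obtain ⟨ρ₂, s₂, g₂, U₂, e₂⟩ := h₂
  have d₁ : DifferentiableAt ℝ ρ₁ z := s₁.differentiable (by simp) z
  have d₂ : DifferentiableAt ℝ ρ₂ z := s₂.differentiable (by simp) z
  have p₁ := norm_pos_iff.2 g₁
  have p₂ := norm_pos_iff.2 g₂
  have f₁ : gradient ρ₁ z = ‖gradient ρ₁ z‖ • ν₁ := by
    rw [e₁, smul_smul, mul_inv_cancel₀ p₁.ne', one_smul]
  have f₂ : gradient ρ₂ z = ‖gradient ρ₂ z‖ • ν₂ := by
    rw [e₂, smul_smul, mul_inv_cancel₀ p₂.ne', one_smul]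
  have i₁ : ⟪gradient ρ₁ z, ν₂ - ν₁⟫ < 0 := by
    rw [f₁, real_inner_smul_left, inner_sub_right, real_inner_self_eq_norm_sq, n₁]
    nlinarith
  have i₂ : 0 < ⟪gradient ρ₂ z, ν₂ - ν₁⟫ := by
    rw [f₂, real_inner_smul_left, inner_sub_right, real_inner_self_eq_norm_sq, n₂,
      real_inner_comm]
    nlinarith
  have ev₁ := eventually_neg_line d₁ (eq_zero_of_sign s₁.continuous.continuousAt U₁ hz) i₁
  have ev₂ := eventually_pos_line d₂ (eq_zero_of_sign s₂.continuous.continuousAt U₂ hz) i₂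
  obtain ⟨t, a, b, c, d⟩ := (ev₁.and (ev₂.and (((tendsto_line z (ν₂ - ν₁)).eventually U₁).and
    ((tendsto_line z (ν₂ - ν₁)).eventually U₂)))).exists
  exact lt_asymm (d.1 (c.2 a)) b

theorem outerNormal_eq {U : Set (Rn n)} {z ν : Rn n} (hz : z ∈ frontier U)
    (h : IsOuterNormal U z ν) : outerNormal U z = ν := by
  have hex : ∃ ν, IsOuterNormal U z ν := ⟨ν, h⟩
  rw [outerNormal, dif_pos hex]
  exact hex.choose_spec.unique hz h

theorem isOuterNormal_outerNormal {U : Set (Rn n)} (hU : HasSmoothBoundary U) {z : Rn n}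
    (hz : z ∈ frontier U) : IsOuterNormal U z (outerNormal U z) := by
  obtain ⟨ν, h⟩ := hU.2 z hz
  rwa [outerNormal_eq hz h]

theorem isCompact_frontier {U : Set (Rn n)} (hb : Bornology.IsBounded U) :
    IsCompact (frontier U) :=
  Metric.isCompact_of_isClosed_isBounded isClosed_frontier
    (hb.closure.subset frontier_subset_closure)

theorem contDiff_gradient {ρ : Rn n → ℝ} (hρ : ContDiff ℝ ∞ ρ) : ContDiff ℝ ∞ (gradient ρ) :=
  (InnerProductSpace.toDual ℝ (Rn n)).symm.contDiff.comp (hρ.fderiv_right (by simp))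

/-- A function vanishing on the boundary of `U`, with the sign of `U`, and strict sign near `A`. -/
structure IsDefiningNear (U A : Set (Rn n)) (ρ : Rn n → ℝ) : Prop where
  smooth : ContDiff ℝ ∞ ρ
  nonpos : ∀ y ∈ U, ρ y ≤ 0
  nonneg : ∀ y ∉ U, 0 ≤ ρ y
  grad : ∀ x ∈ frontier U, ∃ c : ℝ, 0 ≤ c ∧ (x ∈ A → 0 < c) ∧
    gradient ρ x = c • outerNormal U x
  strict : ∃ O, IsOpen O ∧ A ⊆ O ∧ ∀ y ∈ O, y ∉ frontier U → ρ y ≠ 0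

/-- Both summands have the same weak sign at every point, so nothing cancels: the sum vanishes only
where both do, and the gradients add as nonnegative multiples of one normal. This makes local
defining functions patchable without a partition of unity. -/
theorem IsDefiningNear.add {U A B : Set (Rn n)} {ρ σ : Rn n → ℝ} (hρ : IsDefiningNear U A ρ)
    (hσ : IsDefiningNear U B σ) : IsDefiningNear U (A ∪ B) (fun y => ρ y + σ y) where
  smooth := hρ.smooth.add hσ.smooth
  nonpos y hy := add_nonpos (hρ.nonpos y hy) (hσ.nonpos y hy)
  nonneg y hy := add_nonneg (hρ.nonneg y hy) (hσ.nonneg y hy)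
  grad x hx := by
    obtain ⟨a, a0, ha, ea⟩ := hρ.grad x hx
    obtain ⟨b, b0, hb, eb⟩ := hσ.grad x hx
    refine ⟨a + b, add_nonneg a0 b0, ?_, ?_⟩
    · rintro (h | h)
      · exact add_pos_of_pos_of_nonneg (ha h) b0
      · exact add_pos_of_nonneg_of_pos a0 (hb h)
    · rw [add_smul, ← ea, ← eb]
      unfold gradient
      rw [fderiv_fun_add (hρ.smooth.differentiable (by simp) x)
        (hσ.smooth.differentiable (by simp) x), map_add]
  strict := by
    obtain ⟨O, hO, hAO, h⟩ := hρ.strict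
    obtain ⟨P, hP, hBP, h'⟩ := hσ.strict
    refine ⟨O ∪ P, hO.union hP, union_subset_union hAO hBP, fun y hy hyU h0 => ?_⟩
    have key : ρ y = 0 ∧ σ y = 0 := by
      by_cases hyU' : y ∈ U
      · have := hρ.nonpos y hyU'; have := hσ.nonpos y hyU'
        constructor <;> linarith
      · have := hρ.nonneg y hyU'; have := hσ.nonneg y hyU'
        constructor <;> linarith
    rcases hy with hy | hy
    · exact h y hy hyU key.1
    · exact h' y hy hyU key.2

theorem exists_isDefiningNear_nhds {U : Set (Rn n)} (hU : HasSmoothBoundary U) {x : Rn n}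
    (hx : x ∈ frontier U) : ∃ A ∈ 𝓝 x, ∃ ρ, IsDefiningNear U A ρ := by
  obtain ⟨ρ, hs, hg, hsign, -⟩ := isOuterNormal_outerNormal hU hx
  have hg' : ∀ᶠ y in 𝓝 x, gradient ρ y ≠ 0 :=
    (contDiff_gradient hs).continuous.continuousAt.eventually_ne hg
  obtain ⟨r, hr, hball⟩ := Metric.eventually_nhds_iff_ball.1 (hsign.and hg')
  -- The support radius `r / 2` is strictly below `r`, so off the ball of radius `r` the product
  -- vanishes on a whole neighbourhood and its gradient is zero there.
  let φ : ContDiffBump x := ⟨r / 4, r / 2, by positivity, by linarith⟩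
  have hφ0 : ∀ y ∉ Metric.ball x r, φ y = 0 := fun y hy => φ.zero_of_le_dist (by
    simp only [Metric.mem_ball, not_lt] at hy
    change r / 2 ≤ _
    linarith)
  have hev : ∀ y ∈ Metric.ball x r, ∀ᶠ y' in 𝓝 y, y' ∈ U ↔ ρ y' < 0 := fun y hy => by
    filter_upwards [Metric.isOpen_ball.mem_nhds hy] with y' hy' using (hball y' hy').1
  have hsm : ContDiff ℝ ∞ fun y => φ y * ρ y := φ.contDiff.mul hs
  refine ⟨Metric.ball x (r / 4), Metric.ball_mem_nhds _ (by positivity), fun y => φ y * ρ y,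
    hsm, ?_, ?_, ?_, ?_⟩
  · intro y hy
    by_cases hb : y ∈ Metric.ball x r
    · exact mul_nonpos_of_nonneg_of_nonpos φ.nonneg ((hball y hb).1.1 hy).le
    · simp [hφ0 y hb]
  · intro y hy
    by_cases hb : y ∈ Metric.ball x r
    · exact mul_nonneg φ.nonneg (not_lt.1 fun h => hy ((hball y hb).1.2 h))
    · simp [hφ0 y hb]
  · intro y hy
    by_cases hb : y ∈ Metric.ball x r
    · have h0 : ρ y = 0 := eq_zero_of_sign hs.continuous.continuousAt (hev y hb) hy
      have hn : outerNormal U y = ‖gradient ρ y‖⁻¹ • gradient ρ y :=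
        outerNormal_eq hy ⟨ρ, hs, (hball y hb).2, hev y hb, rfl⟩
      have hp := norm_pos_iff.2 (hball y hb).2
      refine ⟨φ y * ‖gradient ρ y‖, mul_nonneg φ.nonneg hp.le, fun hyA => ?_, ?_⟩
      · exact mul_pos (φ.pos_of_mem_ball (by
          simp only [Metric.mem_ball] at hyA ⊢; change _ < r / 2; linarith)) hp
      · rw [hn, smul_smul, mul_assoc, mul_inv_cancel₀ hp.ne', mul_one]
        unfold gradient
        rw [fderiv_fun_mul (φ.contDiff.differentiable (n := ∞) (by simp) y)
          (hs.differentiable (by simp) y), h0]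
        simp
    · refine ⟨0, le_rfl, fun hyA => absurd (Metric.ball_subset_ball (by linarith) hyA) hb, ?_⟩
      have : (fun y => φ y * ρ y) =ᶠ[𝓝 y] fun _ => (0 : ℝ) := by
        have : ∀ᶠ y' in 𝓝 y, r / 2 < dist y' x := by
          apply (continuous_id.dist continuous_const).continuousAt.eventually
          apply lt_mem_nhds
          simp only [Metric.mem_ball, not_lt, id] at hb ⊢
          linarith
        filter_upwards [this] with y' hy'
        rw [φ.zero_of_le_dist hy'.le, zero_mul]
      unfold gradient
      rw [this.fderiv_eq]
      simp
  · refine ⟨Metric.ball x (r / 4), Metric.isOpen_ball, Subset.rfl, fun y hy hyU h0 => hyU ?_⟩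
    have hb : y ∈ Metric.ball x r := Metric.ball_subset_ball (by linarith) hy
    have hφ : φ y ≠ 0 := (φ.pos_of_mem_ball (by
          simp only [Metric.mem_ball] at hy ⊢; change _ < r / 2; linarith)).ne'
    have hρ : ρ y = 0 := (mul_eq_zero.1 h0).resolve_left hφ
    rw [hU.1.frontier_eq]
    -- Moving from a zero of `ρ` against the gradient enters `U` at once, which places the point in
    -- the closure.
    refine ⟨?_, fun h => ((hball y hb).1.1 h).ne hρ⟩
    have ev := eventually_neg_line (w := -gradient ρ y) (hs.differentiable (by simp) y) hρ
      (by rw [inner_neg_right, neg_lt_zero]; exact real_inner_self_pos.2 (hball y hb).2)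
    refine mem_closure_of_tendsto (tendsto_line y (-gradient ρ y)) ?_
    filter_upwards [ev, (tendsto_line y (-gradient ρ y)).eventually (hev y hb)] with t h1 h2
      using h2.2 h1

theorem exists_isDefiningNear {U : Set (Rn n)} (hU : HasSmoothBoundary U)
    (hb : Bornology.IsBounded U) : ∃ ρ, IsDefiningNear U (frontier U) ρ := by
  refine (isCompact_frontier hb).induction_on (p := fun A => ∃ ρ, IsDefiningNear U A ρ) ?_ ?_ ?_ ?_
  · refine ⟨fun _ => 0, contDiff_const, by simp, by simp, fun x _ => ⟨0, le_rfl, by simp, ?_⟩,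
      ∅, isOpen_empty, Subset.rfl, by simp⟩
    simp
  · rintro A B hAB ⟨ρ, h⟩
    refine ⟨ρ, h.smooth, h.nonpos, h.nonneg, fun x hx => ?_, ?_⟩
    · obtain ⟨c, c0, hc, e⟩ := h.grad x hx
      exact ⟨c, c0, fun hA => hc (hAB hA), e⟩
    · obtain ⟨O, hO, hBO, h⟩ := h.strict
      exact ⟨O, hO, hAB.trans hBO, h⟩
  · rintro A B ⟨ρ, h⟩ ⟨σ, h'⟩
    exact ⟨_, h.add h'⟩
  · intro x hx
    obtain ⟨A, hA, h⟩ := exists_isDefiningNear_nhds hU hx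
    exact ⟨A, mem_nhdsWithin_of_mem_nhds hA, h⟩

/-- A smooth function near a closed set agrees near that set with a globally smooth function. -/
theorem exists_contDiff_eqOn_nhdsSet {F : Type*} [NormedAddCommGroup F] [NormedSpace ℝ F]
    {S O : Set (Rn n)} (hS : IsClosed S) (hO : IsOpen O) (hSO : S ⊆ O) {f : Rn n → F}
    (hf : ∀ x ∈ O, ContDiffAt ℝ ∞ f x) :
    ∃ F' : Rn n → F, ContDiff ℝ ∞ F' ∧ ∃ P, IsOpen P ∧ S ⊆ P ∧ P ⊆ O ∧ EqOn F' f P := by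
  obtain ⟨P, hP, hSP, hPO⟩ := normal_exists_closure_subset hS hO hSO
  obtain ⟨χ, h1, h0, -⟩ := exists_contMDiffMap_one_nhds_of_subset_interior (n := (⊤ : ℕ∞))
    (modelWithCornersSelf ℝ (Rn n)) hS (t := P) (by rwa [hP.interior_eq])
  have hχ : ContDiff ℝ ∞ (χ : Rn n → ℝ) := χ.contMDiff.contDiff
  obtain ⟨Q, hQ, hSQ, hQ1⟩ := mem_nhdsSet_iff_exists.1 h1
  refine ⟨fun x => χ x • f x, ?_, Q ∩ P, hQ.inter hP, subset_inter hSQ hSP,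
    inter_subset_right.trans (subset_closure.trans hPO), fun x hx => ?_⟩
  · rw [contDiff_iff_contDiffAt]
    intro x
    by_cases hx : x ∈ closure P
    · exact hχ.contDiffAt.smul (hf x (hPO hx))
    · have : (fun x => χ x • f x) =ᶠ[𝓝 x] fun _ => 0 := by
        filter_upwards [isClosed_closure.isOpen_compl.mem_nhds hx] with y hy
        rw [h0 y fun h => hy (subset_closure h), zero_smul]
      exact contDiffAt_const.congr_of_eventuallyEq this
  · have : χ x = 1 := hQ1 hx.1
    simp [this]

/-! ### Tubular coordinates -/

/-- A smooth map injective on a compact set, with invertible derivative there, has a smooth inverse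
near the image of that set. -/
theorem exists_contDiffAt_inverse {E : Type*} [NormedAddCommGroup E] [NormedSpace ℝ E]
    [CompleteSpace E] {G : E → E} (hG : ContDiff ℝ ∞ G) {K : Set E} (hK : IsCompact K)
    (hinj : InjOn G K)
    (hder : ∀ p ∈ K, fderiv ℝ G p ∈ range ((↑) : (E ≃L[ℝ] E) → E →L[ℝ] E)) :
    ∃ W, IsOpen W ∧ K ⊆ W ∧ ∃ g : E → E, IsOpen (G '' W) ∧ (∀ p ∈ W, g (G p) = p) ∧
      ∀ q ∈ G '' W, ContDiffAt ℝ ∞ g q := by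
  have hstrict : ∀ p, ∀ e : E ≃L[ℝ] E, (e : E →L[ℝ] E) = fderiv ℝ G p → HasFDerivAt G
      (e : E →L[ℝ] E) p := fun p e he => by
    rw [he]; exact (hG.differentiable (by simp) p).hasFDerivAt
  -- Injectivity on a compact set together with local injectivity at its points gives injectivity on
  -- a neighbourhood.
  obtain ⟨V, hV, hKV, hVinj⟩ := hinj.exists_isOpen_superset hK
    (fun p _ => hG.continuous.continuousAt) fun p hp => by
      obtain ⟨e, he⟩ := hder p hp
      have h := hG.contDiffAt.hasStrictFDerivAt' (hstrict p e he) (by simp)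
      exact ⟨(h.toOpenPartialHomeomorph G).source, (h.toOpenPartialHomeomorph G).open_source.mem_nhds
        h.mem_toOpenPartialHomeomorph_source, (h.toOpenPartialHomeomorph G).injOn⟩
  have hcont : Continuous (fderiv ℝ G) := hG.continuous_fderiv (by simp)
  set W := V ∩ fderiv ℝ G ⁻¹' range ((↑) : (E ≃L[ℝ] E) → E →L[ℝ] E) with hW
  have hWo : IsOpen W := hV.inter (ContinuousLinearEquiv.isOpen.preimage hcont)
  have hWinj : InjOn G W := hVinj.mono inter_subset_left
  rcases isEmpty_or_nonempty E with hE | hE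
  · refine ⟨W, hWo, fun p => (hE.false p).elim, G, ?_, fun p => (hE.false p).elim,
      fun p => (hE.false p).elim⟩
    convert isOpen_empty
    exact Set.eq_empty_of_isEmpty _
  set g := Function.invFunOn G W with hg
  have hleft : ∀ p ∈ W, g (G p) = p := fun p hp => hWinj.leftInvOn_invFunOn hp
  -- Near `G p` the local inverse takes values in `W`, where `G` is injective, so it coincides with
  -- the global inverse `g` and passes its smoothness on.
  have hloc : ∀ p ∈ W, ∃ L : E → E, ContDiffAt ℝ ∞ L (G p) ∧
      ∀ᶠ y in 𝓝 (G p), L y ∈ W ∧ G (L y) = y := by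
    intro p hp
    obtain ⟨e, he⟩ := hp.2
    have hs := hG.contDiffAt.hasStrictFDerivAt' (hstrict p e he) (n := ∞) (by simp)
    have hL : ContDiffAt ℝ ∞ (hs.localInverse G e p) (G p) :=
      ContDiffAt.to_localInverse hG.contDiffAt (hstrict p e he) (by simp)
    refine ⟨_, hL, ?_⟩
    have h1 : ∀ᶠ y in 𝓝 (G p), hs.localInverse G e p y ∈ W := by
      apply hL.continuousAt.eventually
      rw [hs.localInverse_apply_image]
      exact hWo.mem_nhds hp
    exact h1.and hs.eventually_right_inverse
  refine ⟨W, hWo, fun p hp => ⟨hKV hp, hder p hp⟩, g, ?_, hleft, ?_⟩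
  · rw [isOpen_iff_mem_nhds]
    rintro _ ⟨p, hp, rfl⟩
    obtain ⟨L, -, h⟩ := hloc p hp
    filter_upwards [h] with y hy using ⟨L y, hy.1, hy.2⟩
  · rintro _ ⟨p, hp, rfl⟩
    obtain ⟨L, hL, h⟩ := hloc p hp
    refine hL.congr_of_eventuallyEq ?_
    filter_upwards [h] with y hy
    conv_lhs => rw [← hy.2]
    exact hleft _ hy.1

/-- Smooth normal coordinates near the boundary of `Ω`: a point `z` of the open set `dom` is
`proj z + sdist z • normal (proj z)` with `proj z ∈ ∂Ω`. All maps are globally smooth. -/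
structure TubularCoords (Ω : Set (Rn n)) where
  /-- a smooth extension of the outer normal -/
  normal : Rn n → Rn n
  /-- the projection to the hypersurface -/
  proj : Rn n → Rn n
  /-- the signed distance -/
  sdist : Rn n → ℝ
  /-- the set where the coordinates are valid -/
  dom : Set (Rn n)
  /-- a lower bound of the width of `dom` -/
  width : ℝ
  normal_smooth : ContDiff ℝ ∞ normal
  proj_smooth : ContDiff ℝ ∞ proj
  sdist_smooth : ContDiff ℝ ∞ sdist
  normal_eq : ∀ x ∈ frontier Ω, normal x = outerNormal Ω x
  norm_normal : ∀ x ∈ frontier Ω, ‖normal x‖ = 1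
  normal_symm : ∀ x ∈ frontier Ω, ∀ σ τ, ⟪σ, normal x⟫ = 0 → ⟪τ, normal x⟫ = 0 →
    ⟪fderiv ℝ normal x σ, τ⟫ = ⟪fderiv ℝ normal x τ, σ⟫
  isOpen_dom : IsOpen dom
  proj_mem : ∀ z ∈ dom, proj z ∈ frontier Ω
  recon : ∀ z ∈ dom, proj z + sdist z • normal (proj z) = z
  inner_fderiv_proj : ∀ z ∈ dom, ∀ ξ, ⟪fderiv ℝ proj z ξ, normal (proj z)⟫ = 0
  width_pos : 0 < width
  mem_dom : ∀ x ∈ frontier Ω, ∀ t : ℝ, |t| ≤ width → x + t • normal x ∈ dom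
  proj_eq : ∀ x ∈ frontier Ω, ∀ t : ℝ, |t| ≤ width → proj (x + t • normal x) = x
  sdist_eq : ∀ x ∈ frontier Ω, ∀ t : ℝ, |t| ≤ width → sdist (x + t • normal x) = t

theorem IsDefiningNear.eq_zero {U A : Set (Rn n)} {ρ : Rn n → ℝ} (h : IsDefiningNear U A ρ)
    {x : Rn n} (hx : x ∈ frontier U) : ρ x = 0 :=
  eq_zero_of_mem_frontier h.smooth.continuous.continuousAt (Eventually.of_forall h.nonpos)
    (Eventually.of_forall h.nonneg) hx

theorem inner_fderiv_gradient_comm {ρ : Rn n → ℝ} (hρ : ContDiff ℝ ∞ ρ) (x σ τ : Rn n) :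
    ⟪fderiv ℝ (gradient ρ) x σ, τ⟫ = ⟪fderiv ℝ (gradient ρ) x τ, σ⟫ := by
  have key : ∀ σ τ, ⟪fderiv ℝ (gradient ρ) x σ, τ⟫ = fderiv ℝ (fderiv ℝ ρ) x σ τ := by
    intro σ τ
    have hd : DifferentiableAt ℝ (gradient ρ) x :=
      (contDiff_gradient hρ).differentiable (by simp) x
    have hd' : DifferentiableAt ℝ (fderiv ℝ ρ) x :=
      (hρ.fderiv_right (m := ∞) (by simp)).differentiable (by simp) x
    have h1 : HasFDerivAt (fun y => ⟪τ, gradient ρ y⟫)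
        ((innerSL ℝ τ).comp (fderiv ℝ (gradient ρ) x)) x :=
      (innerSL ℝ τ).hasFDerivAt.comp x hd.hasFDerivAt
    have h2 : HasFDerivAt (fun y => ⟪τ, gradient ρ y⟫)
        ((ContinuousLinearMap.apply ℝ ℝ τ).comp (fderiv ℝ (fderiv ℝ ρ) x)) x := by
      simpa [inner_gradient_left, real_inner_comm τ] using!
        (ContinuousLinearMap.apply ℝ ℝ τ).hasFDerivAt.comp x hd'.hasFDerivAt
    have := congrArg (fun L => L σ) (h1.unique h2)
    simpa [real_inner_comm] using this
  rw [key, key]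
  exact (hρ.contDiffAt.isSymmSndFDerivAt (by
    rw [minSmoothness_of_isRCLikeNormedField]
    exact WithTop.coe_le_coe.2 (le_top : (2 : ℕ∞) ≤ ⊤))) σ τ

/-- Take `∇ρ / |∇ρ|`. Its derivative is a multiple of the Hessian, which is symmetric, plus a term
along `∇ρ`, which disappears when paired with tangent vectors; hence the shape operator is
symmetric. -/
theorem exists_smooth_normal {Ω : Set (Rn n)} {ρ : Rn n → ℝ}
    (hρ : IsDefiningNear Ω (frontier Ω) ρ) (hΩ : HasSmoothBoundary Ω) :
    ∃ N : Rn n → Rn n, ContDiff ℝ ∞ N ∧ (∀ x ∈ frontier Ω, N x = outerNormal Ω x) ∧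
      ∀ x ∈ frontier Ω, ∀ σ τ, ⟪σ, N x⟫ = 0 → ⟪τ, N x⟫ = 0 →
        ⟪fderiv ℝ N x σ, τ⟫ = ⟪fderiv ℝ N x τ, σ⟫ := by
  have hg := contDiff_gradient hρ.smooth
  have hO : IsOpen {x | gradient ρ x ≠ 0} := isOpen_ne.preimage hg.continuous
  have hn1 : ∀ x ∈ frontier Ω, ‖outerNormal Ω x‖ = 1 := fun x hx =>
    norm_outer_normal (isOuterNormal_outerNormal hΩ hx)
  have hne : ∀ x ∈ frontier Ω, gradient ρ x ≠ 0 := by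
    intro x hx
    obtain ⟨c, -, hc, e⟩ := hρ.grad x hx
    rw [e]
    exact smul_ne_zero (hc hx).ne' (norm_ne_zero_iff.1 (by rw [hn1 x hx]; simp))
  have hsm : ∀ x ∈ {x | gradient ρ x ≠ 0},
      ContDiffAt ℝ ∞ (fun x => ‖gradient ρ x‖⁻¹) x := fun x hx =>
    (hg.contDiffAt.norm ℝ hx).inv (norm_ne_zero_iff.2 hx)
  obtain ⟨N, hN, P, hP, hSP, hPO, heq⟩ := exists_contDiff_eqOn_nhdsSet isClosed_frontier hO hne
    (f := fun x => ‖gradient ρ x‖⁻¹ • gradient ρ x) fun x hx => (hsm x hx).smul hg.contDiffAt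
  refine ⟨N, hN, fun x hx => ?_, fun x hx => ?_⟩
  · obtain ⟨c, -, hc, e⟩ := hρ.grad x hx
    rw [heq (hSP hx)]
    simp only
    rw [e, norm_smul, hn1 x hx, mul_one, smul_smul, Real.norm_of_nonneg (hc hx).le,
      inv_mul_cancel₀ (hc hx).ne', one_smul]
  · have hd : ∀ σ, fderiv ℝ N x σ = ‖gradient ρ x‖⁻¹ • fderiv ℝ (gradient ρ) x σ +
        fderiv ℝ (fun x => ‖gradient ρ x‖⁻¹) x σ • gradient ρ x := by
      intro σ
      rw [(heq.eventuallyEq_of_mem (hP.mem_nhds (hSP hx))).fderiv_eq,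
        fderiv_fun_smul ((hsm x (hne x hx)).differentiableAt (by simp))
          (hg.differentiable (by simp) x)]
      simp
    intro σ τ hσ hτ
    rw [heq (hSP hx)] at hσ hτ
    simp only [inner_smul_right, mul_eq_zero, inv_eq_zero, norm_eq_zero, hne x hx, false_or]
      at hσ hτ
    rw [hd, hd, inner_add_left, inner_add_left, real_inner_smul_left, real_inner_smul_left,
      real_inner_smul_left, real_inner_smul_left, real_inner_comm σ (gradient ρ x),
      real_inner_comm τ (gradient ρ x), hσ, hτ, inner_fderiv_gradient_comm hρ.smooth, mul_zero,
      mul_zero]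

/-- The map `(x, t) ↦ (x + t N(x), ρ(x))` of `ℝⁿ × ℝ` fixes `S × {0}` and has invertible derivative
there. Inverting it at `(z, 0)` yields projection and signed distance together; the second component
says that the foot point lies on `{ρ = 0}`. No charts of `S` are needed. -/
theorem exists_tubularCoords {Ω : Set (Rn n)} (hΩ : HasSmoothBoundary Ω)
    (hb : Bornology.IsBounded Ω) : Nonempty (TubularCoords Ω) := by
  obtain ⟨ρ, hρ⟩ := exists_isDefiningNear hΩ hb
  obtain ⟨N, hN, hNeq, hNsymm⟩ := exists_smooth_normal hρ hΩ
  have hS := isCompact_frontier hb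
  have hn1 : ∀ x ∈ frontier Ω, ‖N x‖ = 1 := fun x hx => by
    rw [hNeq x hx]; exact norm_outer_normal (isOuterNormal_outerNormal hΩ hx)
  have hρ0 : ∀ x ∈ frontier Ω, ρ x = 0 := fun x hx => hρ.eq_zero hx
  let G : Rn n × ℝ → Rn n × ℝ := fun p => (p.1 + p.2 • N p.1, ρ p.1)
  have hG : ContDiff ℝ ∞ G :=
    (contDiff_fst.add (contDiff_snd.smul (hN.comp contDiff_fst))).prodMk
      (hρ.smooth.comp contDiff_fst)
  have hGS : ∀ x ∈ frontier Ω, G (x, 0) = (x, 0) := fun x hx => by simp [G, hρ0 x hx]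
  have hK : IsCompact ((fun x : Rn n => (x, (0 : ℝ))) '' frontier Ω) :=
    hS.image (by fun_prop)
  obtain ⟨W, hW, hKW, g, hGW, hgG, hg⟩ := exists_contDiffAt_inverse hG hK
    (by
      rintro _ ⟨x, hx, rfl⟩ _ ⟨y, hy, rfl⟩ h
      simpa only [hGS x hx, hGS y hy] using h)
    (by
      rintro _ ⟨x, hx, rfl⟩
      have hd : ∀ q : Rn n × ℝ, fderiv ℝ G (x, 0) q = (q.1 + q.2 • N x, ⟪gradient ρ x, q.1⟫) := by
        intro q
        have h1 : HasFDerivAt (fun p : Rn n × ℝ => N p.1)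
            ((fderiv ℝ N x).comp (ContinuousLinearMap.fst ℝ (Rn n) ℝ)) (x, 0) :=
          HasFDerivAt.comp (x, (0 : ℝ)) (f := Prod.fst)
            (hN.differentiable (by simp) x).hasFDerivAt hasFDerivAt_fst
        have h2 : HasFDerivAt (fun p : Rn n × ℝ => ρ p.1)
            ((fderiv ℝ ρ x).comp (ContinuousLinearMap.fst ℝ (Rn n) ℝ)) (x, 0) :=
          HasFDerivAt.comp (x, (0 : ℝ)) (f := Prod.fst)
            (hρ.smooth.differentiable (by simp) x).hasFDerivAt hasFDerivAt_fst
        have h3 := (hasFDerivAt_fst.add (hasFDerivAt_snd.smul h1)).prodMk h2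
        rw [HasFDerivAt.fderiv (f := G) h3]
        simp [inner_gradient_left]
      -- A kernel vector satisfies `ξ = -s N`; the second component then reads `c s = 0` with `c >
      -- 0`.
      have hinj : Function.Injective (fderiv ℝ G (x, 0) : Rn n × ℝ →ₗ[ℝ] Rn n × ℝ) := by
        rw [injective_iff_map_eq_zero]
        rintro ⟨ξ, s⟩ h
        obtain ⟨c, -, hc, e⟩ := hρ.grad x hx
        have h' := hd (ξ, s)
        rw [ContinuousLinearMap.coe_coe] at h
        rw [h] at h'
        simp only [Prod.zero_eq_mk, Prod.mk.injEq] at h' ⊢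
        have e1 : ξ = -(s • N x) := eq_neg_of_add_eq_zero_left h'.1.symm
        have e2 := h'.2
        rw [e1, e, ← hNeq x hx, inner_neg_right, real_inner_smul_left, inner_smul_right,
          real_inner_self_eq_norm_sq, hn1 x hx] at e2
        have hs : s = 0 := by
          have : c * s = 0 := by linarith
          exact (mul_eq_zero.1 this).resolve_left (hc hx).ne'
        exact ⟨by rw [e1, hs]; simp, hs⟩
      refine ⟨(LinearEquiv.ofInjectiveEndo _ hinj).toContinuousLinearEquiv, ?_⟩
      ext q <;> rfl)
  obtain ⟨Q, hQ, hSQ, hQρ⟩ := hρ.strict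
  have hgS : ∀ x ∈ frontier Ω, g (x, 0) = (x, 0) := fun x hx => by
    have := hgG (x, 0) (hKW ⟨x, hx, rfl⟩)
    rwa [hGS x hx] at this
  -- the set where the inverse is defined and its first component is close to the hypersurface
  have hcg : ContinuousOn g (G '' W) := fun q hq => (hg q hq).continuousAt.continuousWithinAt
  have hO₁ : IsOpen (G '' W ∩ g ⁻¹' (Q ×ˢ univ)) := hcg.isOpen_inter_preimage hGW
    (hQ.prod isOpen_univ)
  set O : Set (Rn n) := (fun z => (z, (0 : ℝ))) ⁻¹' (G '' W ∩ g ⁻¹' (Q ×ˢ univ)) with hOdef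
  have hO : IsOpen O := hO₁.preimage (by fun_prop)
  have hSO : frontier Ω ⊆ O := fun x hx =>
    ⟨⟨(x, 0), hKW ⟨x, hx, rfl⟩, hGS x hx⟩, by
      simp only [mem_preimage, hgS x hx]; exact ⟨hSQ hx, trivial⟩⟩
  have hsm : ∀ z ∈ O, ContDiffAt ℝ ∞ (fun z => g (z, 0)) z := fun z hz =>
    ContDiffAt.comp z (hg _ hz.1) (contDiff_id.prodMk contDiff_const).contDiffAt
  have hright : ∀ z ∈ O, G (g (z, 0)) = (z, 0) := fun z hz => by
    obtain ⟨p, hp, hpe⟩ := hz.1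
    simp only at hpe
    rw [← hpe, hgG p hp]
  have hρg : ∀ z ∈ O, ρ (g (z, 0)).1 = 0 := fun z hz => congrArg Prod.snd (hright z hz)
  have hrec : ∀ z ∈ O, (g (z, 0)).1 + (g (z, 0)).2 • N (g (z, 0)).1 = z := fun z hz =>
    congrArg Prod.fst (hright z hz)
  -- The zeros of `ρ` lie on `S` only inside `Q`, which is why `O` also confines the foot point to
  -- `Q`.
  have hmem : ∀ z ∈ O, (g (z, 0)).1 ∈ frontier Ω := fun z hz => by
    by_contra h
    exact hQρ _ hz.2.1 h (hρg z hz)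
  obtain ⟨Φ, hΦ, P, hP, hSP, hPO, heq⟩ := exists_contDiff_eqOn_nhdsSet isClosed_frontier hO hSO hsm
  have hwid : ∀ᶠ t : ℝ in 𝓝 0, ∀ x ∈ frontier Ω, x + t • N x ∈ P ∧ (x, t) ∈ W := by
    apply hS.eventually_forall_of_forall_eventually
    intro x hx
    have c1 : ContinuousAt (fun z : ℝ × Rn n => z.2 + z.1 • N z.2) (0, x) :=
      (continuous_snd.add (continuous_fst.smul (hN.continuous.comp continuous_snd))).continuousAt
    have c2 : ContinuousAt (fun z : ℝ × Rn n => (z.2, z.1)) (0, x) := by fun_prop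
    refine (c1.eventually ?_).and (c2.eventually ?_)
    · simpa using hP.mem_nhds (hSP hx)
    · exact hW.mem_nhds (hKW ⟨x, hx, rfl⟩)
  obtain ⟨ε, hε, hwid⟩ := Metric.eventually_nhds_iff_ball.1 hwid
  have hwid' : ∀ x ∈ frontier Ω, ∀ t : ℝ, |t| ≤ ε / 2 → x + t • N x ∈ P ∧ (x, t) ∈ W :=
    fun x hx t ht => hwid t (by rw [mem_ball_zero_iff, Real.norm_eq_abs]; linarith) x hx
  have hΦeq : ∀ x ∈ frontier Ω, ∀ t : ℝ, |t| ≤ ε / 2 → Φ (x + t • N x) = (x, t) := by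
    intro x hx t ht
    rw [heq (hwid' x hx t ht).1]
    have := hgG _ (hwid' x hx t ht).2
    simpa [G, hρ0 x hx] using this
  refine ⟨{
    normal := N
    proj := fun z => (Φ z).1
    sdist := fun z => (Φ z).2
    dom := P
    width := ε / 2
    normal_smooth := hN
    proj_smooth := hΦ.fst
    sdist_smooth := hΦ.snd
    normal_eq := hNeq
    norm_normal := hn1
    normal_symm := hNsymm
    isOpen_dom := hP
    proj_mem := fun z hz => by rw [heq hz]; exact hmem z (hPO hz)
    recon := fun z hz => by rw [heq hz]; exact hrec z (hPO hz)
    inner_fderiv_proj := ?_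
    width_pos := by positivity
    mem_dom := fun x hx t ht => (hwid' x hx t ht).1
    proj_eq := fun x hx t ht => by rw [hΦeq x hx t ht]
    sdist_eq := fun x hx t ht => by rw [hΦeq x hx t ht] }⟩
  intro z hz ξ
  have hm : (Φ z).1 ∈ frontier Ω := by rw [heq hz]; exact hmem z (hPO hz)
  -- Differentiating `ρ ∘ proj = 0` makes the image of the derivative of the projection orthogonal
  -- to `∇ρ`, a positive multiple of the normal.
  have h0 : (fun z => ρ (Φ z).1) =ᶠ[𝓝 z] fun _ => 0 := by
    filter_upwards [hP.mem_nhds hz] with y hy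
    rw [heq hy]; exact hρg y (hPO hy)
  have h1 : HasFDerivAt (fun z => ρ (Φ z).1)
      ((fderiv ℝ ρ (Φ z).1).comp (fderiv ℝ (fun z => (Φ z).1) z)) z :=
    HasFDerivAt.comp z (f := fun z => (Φ z).1) (hρ.smooth.differentiable (by simp) _).hasFDerivAt
      (hΦ.fst.differentiable (by simp) z).hasFDerivAt
  have h2 := h1.unique ((hasFDerivAt_const (0 : ℝ) z).congr_of_eventuallyEq h0)
  have h3 := congrArg (fun L => L ξ) h2
  simp only [ContinuousLinearMap.comp_apply, zero_apply] at h3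
  obtain ⟨c, -, hc, e⟩ := hρ.grad _ hm
  rw [← inner_gradient_left, e, real_inner_smul_left] at h3
  rw [hNeq _ hm, real_inner_comm]
  exact (mul_eq_zero.1 h3).resolve_left (hc hm).ne'

/-! ### Calculus in tubular coordinates -/

namespace TubularCoords

variable {Ω : Set (Rn n)} (T : TubularCoords Ω)

include T

theorem mem_dom_self {x : Rn n} (hx : x ∈ frontier Ω) : x ∈ T.dom := by
  simpa using T.mem_dom x hx 0 (by simpa using T.width_pos.le)

theorem proj_self {x : Rn n} (hx : x ∈ frontier Ω) : T.proj x = x := by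
  simpa using T.proj_eq x hx 0 (by simpa using T.width_pos.le)

theorem sdist_self {x : Rn n} (hx : x ∈ frontier Ω) : T.sdist x = 0 := by
  simpa using T.sdist_eq x hx 0 (by simpa using T.width_pos.le)

theorem hasFDerivAt_proj (z : Rn n) : HasFDerivAt T.proj (fderiv ℝ T.proj z) z :=
  (T.proj_smooth.differentiable (by simp) z).hasFDerivAt

theorem hasFDerivAt_sdist (z : Rn n) : HasFDerivAt T.sdist (fderiv ℝ T.sdist z) z :=
  (T.sdist_smooth.differentiable (by simp) z).hasFDerivAt

theorem hasFDerivAt_normal (z : Rn n) : HasFDerivAt T.normal (fderiv ℝ T.normal z) z :=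
  (T.normal_smooth.differentiable (by simp) z).hasFDerivAt

theorem hasFDerivAt_comp_proj {F : Type*} [NormedAddCommGroup F] [NormedSpace ℝ F]
    {f : Rn n → F} {z : Rn n} (hf : DifferentiableAt ℝ f (T.proj z)) :
    HasFDerivAt (fun y => f (T.proj y)) ((fderiv ℝ f (T.proj z)).comp (fderiv ℝ T.proj z)) z :=
  HasFDerivAt.comp z hf.hasFDerivAt (T.hasFDerivAt_proj z)

theorem fderiv_recon {z : Rn n} (hz : z ∈ T.dom) (ξ : Rn n) :
    fderiv ℝ T.proj z ξ + (T.sdist z • fderiv ℝ T.normal (T.proj z) (fderiv ℝ T.proj z ξ)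
      + fderiv ℝ T.sdist z ξ • T.normal (T.proj z)) = ξ := by
  have h1 := (T.hasFDerivAt_proj z).add ((T.hasFDerivAt_sdist z).smul
    (T.hasFDerivAt_comp_proj (T.hasFDerivAt_normal (T.proj z)).differentiableAt))
  have h2 : (T.proj + T.sdist • fun y => T.normal (T.proj y)) =ᶠ[𝓝 z] id := by
    filter_upwards [T.isOpen_dom.mem_nhds hz] with y hy using T.recon y hy
  have h3 := h1.unique ((hasFDerivAt_id z).congr_of_eventuallyEq h2)
  simpa using congrArg (fun L => L ξ) h3

theorem fderiv_sdist_tangent {x τ : Rn n} (hx : x ∈ frontier Ω) (hτ : ⟪τ, T.normal x⟫ = 0) :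
    fderiv ℝ T.sdist x τ = 0 := by
  have h := T.fderiv_recon (T.mem_dom_self hx) τ
  rw [T.sdist_self hx, zero_smul, zero_add, T.proj_self hx] at h
  have h' := congrArg (fun w => ⟪w, T.normal x⟫) h
  have h0 := T.inner_fderiv_proj x (T.mem_dom_self hx) τ
  rw [T.proj_self hx] at h0
  simp only [inner_add_left, h0, real_inner_smul_left, real_inner_self_eq_norm_sq,
    T.norm_normal x hx, hτ] at h'
  linarith

theorem fderiv_proj_tangent {x τ : Rn n} (hx : x ∈ frontier Ω) (hτ : ⟪τ, T.normal x⟫ = 0) :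
    fderiv ℝ T.proj x τ = τ := by
  have h := T.fderiv_recon (T.mem_dom_self hx) τ
  rwa [T.sdist_self hx, zero_smul, zero_add, T.fderiv_sdist_tangent hx hτ, zero_smul,
    add_zero] at h

theorem eventually_abs_le {t : ℝ} (ht : |t| < T.width) : ∀ᶠ s in 𝓝 t, |s| ≤ T.width :=
  (continuous_abs.continuousAt.eventually (gt_mem_nhds ht)).mono fun _ h => le_of_lt h

theorem fderiv_proj_normal {x : Rn n} (hx : x ∈ frontier Ω) {t : ℝ} (ht : |t| < T.width) :
    fderiv ℝ T.proj (x + t • T.normal x) (T.normal x) = 0 := by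
  have h := hasDerivAt_line (f := T.proj) (z := x) (w := T.normal x) (t := t)
    (T.hasFDerivAt_proj _).differentiableAt
  refine h.unique ((hasDerivAt_const t x).congr_of_eventuallyEq ?_)
  filter_upwards [T.eventually_abs_le ht] with s hs using T.proj_eq x hx s hs

theorem fderiv_sdist_normal {x : Rn n} (hx : x ∈ frontier Ω) {t : ℝ} (ht : |t| < T.width) :
    fderiv ℝ T.sdist (x + t • T.normal x) (T.normal x) = 1 := by
  have h := hasDerivAt_line (f := T.sdist) (z := x) (w := T.normal x) (t := t)
    (T.hasFDerivAt_sdist _).differentiableAt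
  refine h.unique ((hasDerivAt_id t).congr_of_eventuallyEq ?_)
  filter_upwards [T.eventually_abs_le ht] with s hs using T.sdist_eq x hx s hs

/-- The derivative at `x ∈ ∂Ω` of `y ↦ proj y + t • normal (proj y)`, in a tangent direction. -/
theorem hasFDerivAt_parallel (x : Rn n) (t : ℝ) :
    HasFDerivAt (fun y => T.proj y + t • T.normal (T.proj y))
      (fderiv ℝ T.proj x + t • (fderiv ℝ T.normal (T.proj x)).comp (fderiv ℝ T.proj x)) x :=
  (T.hasFDerivAt_proj x).add
    ((T.hasFDerivAt_comp_proj (T.hasFDerivAt_normal (T.proj x)).differentiableAt).const_smul t)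

/-- Differentiate `proj (y + t n(y)) = y` along `S`. Together with the analogous identity for
`sdist`, this says that `(Id + tΠ)τ` is tangent to the parallel surface at height `t` and projects
to `τ`. -/
theorem fderiv_proj_parallel {x τ : Rn n} (hx : x ∈ frontier Ω) {t : ℝ} (ht : |t| < T.width)
    (hτ : ⟪τ, T.normal x⟫ = 0) :
    fderiv ℝ T.proj (x + t • T.normal x) (τ + t • fderiv ℝ T.normal x τ) = τ := by
  have h := HasFDerivAt.comp x (T.hasFDerivAt_proj _) (T.hasFDerivAt_parallel x t)
  have e : (T.proj ∘ fun y => T.proj y + t • T.normal (T.proj y)) =ᶠ[𝓝 x] T.proj := by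
    filter_upwards [T.isOpen_dom.mem_nhds (T.mem_dom_self hx)] with y hy
    exact T.proj_eq _ (T.proj_mem y hy) t ht.le
  have h' := congrArg (fun L => L τ) (h.unique ((T.hasFDerivAt_proj x).congr_of_eventuallyEq e))
  simpa [T.proj_self hx, T.fderiv_proj_tangent hx hτ] using h'

theorem fderiv_sdist_parallel {x τ : Rn n} (hx : x ∈ frontier Ω) {t : ℝ} (ht : |t| < T.width)
    (hτ : ⟪τ, T.normal x⟫ = 0) :
    fderiv ℝ T.sdist (x + t • T.normal x) (τ + t • fderiv ℝ T.normal x τ) = 0 := by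
  have h := HasFDerivAt.comp x (T.hasFDerivAt_sdist _) (T.hasFDerivAt_parallel x t)
  have e : (T.sdist ∘ fun y => T.proj y + t • T.normal (T.proj y)) =ᶠ[𝓝 x] fun _ => t := by
    filter_upwards [T.isOpen_dom.mem_nhds (T.mem_dom_self hx)] with y hy
    exact T.sdist_eq _ (T.proj_mem y hy) t ht.le
  have h' := congrArg (fun L => L τ) (h.unique ((hasFDerivAt_const t x).congr_of_eventuallyEq e))
  simpa [T.proj_self hx, T.fderiv_proj_tangent hx hτ] using h'

/-! #### Tangential derivatives -/

/-- The projection maps an open set into `S` and its derivative fixes tangent vectors, so it carries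
the full tangent cone onto tangent directions of `S`. -/
theorem mem_tangentConeAt {x τ : Rn n} (hx : x ∈ frontier Ω) (hτ : ⟪τ, T.normal x⟫ = 0) :
    τ ∈ tangentConeAt ℝ (frontier Ω) x := by
  have hu : τ ∈ tangentConeAt ℝ T.dom x := by
    rw [tangentConeAt_of_mem_nhds (T.isOpen_dom.mem_nhds (T.mem_dom_self hx))]; trivial
  have h := ((T.hasFDerivAt_proj x).hasFDerivWithinAt (s := T.dom)).mapsTo_tangent_cone hu
  rw [T.fderiv_proj_tangent hx hτ, T.proj_self hx] at h
  refine tangentConeAt_mono ?_ h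
  rintro _ ⟨z, hz, rfl⟩
  exact T.proj_mem z hz

theorem isTangent_iff {x τ : Rn n} (hx : x ∈ frontier Ω) :
    IsTangent Ω x τ ↔ ⟪τ, T.normal x⟫ = 0 := by
  rw [IsTangent, T.normal_eq x hx]

/-- Derivatives within `S` are determined on its tangent cone, so tangential derivatives may be
computed from any differentiable extension. -/
theorem fderivWithin_eq {F : Type*} [NormedAddCommGroup F] [NormedSpace ℝ F]
    {f f' : Rn n → F} (h : EqOn f f' (frontier Ω)) {x τ : Rn n} (hx : x ∈ frontier Ω)
    (hf : DifferentiableAt ℝ f' x) (hτ : ⟪τ, T.normal x⟫ = 0) :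
    fderivWithin ℝ f (frontier Ω) x τ = fderiv ℝ f' x τ := by
  have h1 : HasFDerivWithinAt f (fderiv ℝ f' x) (frontier Ω) x :=
    hf.hasFDerivAt.hasFDerivWithinAt.congr h (h hx)
  exact h1.differentiableWithinAt.hasFDerivWithinAt.unique_on h1 (T.mem_tangentConeAt hx hτ)

theorem inner_surfGrad {g g' : Rn n → ℝ} (h : EqOn g g' (frontier Ω)) {x τ : Rn n}
    (hx : x ∈ frontier Ω) (hg : DifferentiableAt ℝ g' x) (hτ : ⟪τ, T.normal x⟫ = 0) :
    ⟪surfGrad Ω g x, τ⟫ = fderiv ℝ g' x τ := by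
  rw [surfGrad, inner_sub_left, real_inner_smul_left, ← T.normal_eq x hx,
    real_inner_comm τ (T.normal x), hτ, mul_zero, sub_zero, inner_gradientWithin_left,
    T.fderivWithin_eq h hx hg hτ]

theorem fderiv_eq_zero_of_const {F : Type*} [NormedAddCommGroup F] [NormedSpace ℝ F]
    {f : Rn n → F} {c : F} (h : ∀ y ∈ frontier Ω, f y = c) {x τ : Rn n} (hx : x ∈ frontier Ω)
    (hf : DifferentiableAt ℝ f x) (hτ : ⟪τ, T.normal x⟫ = 0) : fderiv ℝ f x τ = 0 := by
  rw [← T.fderivWithin_eq (f := fun _ => c) (fun y hy => (h y hy).symm) hx hf hτ]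
  simp

theorem inner_fderiv_normal_normal {x τ : Rn n} (hx : x ∈ frontier Ω)
    (hτ : ⟪τ, T.normal x⟫ = 0) : ⟪fderiv ℝ T.normal x τ, T.normal x⟫ = 0 := by
  have hd := (T.hasFDerivAt_normal x).differentiableAt
  have h := T.fderiv_eq_zero_of_const (f := fun y => ⟪T.normal y, T.normal y⟫) (c := 1)
    (fun y hy => by rw [real_inner_self_eq_norm_sq, T.norm_normal y hy, one_pow]) hx
    (hd.inner ℝ hd) hτ
  rw [fderiv_inner_apply ℝ hd hd, real_inner_comm] at h
  linarith

theorem inner_fderiv_field_normal {V : Rn n → Rn n} (hV : ContDiff ℝ ∞ V)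
    (hVt : ∀ y ∈ frontier Ω, ⟪V y, T.normal y⟫ = 0) {x τ : Rn n} (hx : x ∈ frontier Ω)
    (hτ : ⟪τ, T.normal x⟫ = 0) :
    ⟪fderiv ℝ V x τ, T.normal x⟫ = -⟪V x, fderiv ℝ T.normal x τ⟫ := by
  have hd := (T.hasFDerivAt_normal x).differentiableAt
  have hdV := hV.differentiable (by simp) x
  have h := T.fderiv_eq_zero_of_const (f := fun y => ⟪V y, T.normal y⟫) (c := 0) hVt hx
    (hdV.inner ℝ hd) hτ
  rw [fderiv_inner_apply ℝ hdV hd] at h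
  linarith

/-! #### The extension of a tangent field -/

omit T in
/-- The field `(Id + t Π) V` in tubular coordinates. -/
noncomputable def extMain (T : TubularCoords Ω) (V : Rn n → Rn n) (z : Rn n) : Rn n :=
  V (T.proj z) + T.sdist z • fderiv ℝ T.normal (T.proj z) (V (T.proj z))

omit T in
/-- The field `(n ⊗ ∇g) V` in tubular coordinates. -/
noncomputable def extCorr (T : TubularCoords Ω) (g : Rn n → ℝ) (V : Rn n → Rn n) (z : Rn n) :
    Rn n :=
  fderiv ℝ g (T.proj z) (V (T.proj z)) • T.normal (T.proj z)

theorem contDiff_extMain {V : Rn n → Rn n} (hV : ContDiff ℝ ∞ V) :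
    ContDiff ℝ ∞ (T.extMain V) := by
  have h1 : ContDiff ℝ ∞ fun z => V (T.proj z) := hV.comp T.proj_smooth
  have h2 : ContDiff ℝ ∞ fun z => fderiv ℝ T.normal (T.proj z) :=
    (T.normal_smooth.fderiv_right (m := ∞) (by simp)).comp T.proj_smooth
  exact h1.add (T.sdist_smooth.smul (h2.clm_apply h1))

theorem contDiff_extCorr {g : Rn n → ℝ} {V : Rn n → Rn n} (hg : ContDiff ℝ ∞ g)
    (hV : ContDiff ℝ ∞ V) : ContDiff ℝ ∞ (T.extCorr g V) := by
  have h1 : ContDiff ℝ ∞ fun z => V (T.proj z) := hV.comp T.proj_smooth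
  have h2 : ContDiff ℝ ∞ fun z => fderiv ℝ g (T.proj z) :=
    (hg.fderiv_right (m := ∞) (by simp)).comp T.proj_smooth
  exact (h2.clm_apply h1).smul (T.normal_smooth.comp T.proj_smooth)

/-- The term containing the derivative of `Π v` carries the factor `sdist`, which is zero on `S`. -/
theorem fderiv_extMain {V : Rn n → Rn n} (hV : ContDiff ℝ ∞ V) {x : Rn n}
    (hx : x ∈ frontier Ω) (ξ : Rn n) :
    fderiv ℝ (T.extMain V) x ξ = fderiv ℝ V x (fderiv ℝ T.proj x ξ) +
      fderiv ℝ T.sdist x ξ • fderiv ℝ T.normal x (V x) := by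
  have h1 := T.hasFDerivAt_comp_proj (z := x) (hV.differentiable (by simp) (T.proj x))
  have h2 : DifferentiableAt ℝ (fun z => fderiv ℝ T.normal (T.proj z) (V (T.proj z))) x :=
    ((((T.normal_smooth.fderiv_right (m := ∞) (by simp)).comp T.proj_smooth).clm_apply
      (hV.comp T.proj_smooth)).differentiable (by simp) x)
  have h3 := h1.add ((T.hasFDerivAt_sdist x).smul h2.hasFDerivAt)
  rw [HasFDerivAt.fderiv (f := T.extMain V) h3]
  simp [T.proj_self hx, T.sdist_self hx]

/-- The symmetric part of the derivative of `extMain V` vanishes on the hypersurface if `V` is a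
Killing field. -/
theorem inner_fderiv_extMain {V : Rn n → Rn n} (hV : ContDiff ℝ ∞ V)
    (hVt : ∀ y ∈ frontier Ω, ⟪V y, T.normal y⟫ = 0)
    (hVk : ∀ y ∈ frontier Ω, ∀ τ, ⟪τ, T.normal y⟫ = 0 → ⟪fderiv ℝ V y τ, τ⟫ = 0)
    {x : Rn n} (hx : x ∈ frontier Ω) (ξ : Rn n) :
    ⟪fderiv ℝ (T.extMain V) x ξ, ξ⟫ = 0 := by
  have hrec := T.fderiv_recon (T.mem_dom_self hx) ξ
  have ht := T.inner_fderiv_proj x (T.mem_dom_self hx) ξ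
  rw [T.sdist_self hx, zero_smul, zero_add, T.proj_self hx] at hrec
  rw [T.proj_self hx] at ht
  rw [T.fderiv_extMain hV hx]
  set τ := fderiv ℝ T.proj x ξ
  set s := fderiv ℝ T.sdist x ξ
  -- With `ξ = τ + s n`, the Killing equation removes the `ττ` term, `Πv · n = 0` removes the `nn`
  -- term, and the two mixed terms cancel by symmetry of `Π`.
  rw [← hrec]
  simp only [inner_add_left, inner_add_right, real_inner_smul_left, inner_smul_right,
    hVk x hx τ ht, T.inner_fderiv_normal_normal hx (hVt x hx),
    T.inner_fderiv_field_normal hV hVt hx ht, T.normal_symm x hx _ _ (hVt x hx) ht,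
    real_inner_comm (V x) (fderiv ℝ T.normal x τ)]
  ring

/-- Otherwise `V` is locally constant along `S`. On the compact level set `V = a`, with `a ≠ 0`, the
function `⟨a, x⟩` attains a maximum, which is local on all of `S`; yet `a` is tangent there and the
derivative along it is `|a|²`. -/
theorem exists_fderiv_extMain_ne_zero (hb : Bornology.IsBounded Ω) {V : Rn n → Rn n}
    (hV : ContDiff ℝ ∞ V)
    (hVt : ∀ y ∈ frontier Ω, ⟪V y, T.normal y⟫ = 0) (hV0 : ∃ y ∈ frontier Ω, V y ≠ 0) :
    ∃ x ∈ frontier Ω, fderiv ℝ (T.extMain V) x ≠ 0 := by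
  by_contra! hcon
  obtain ⟨x₁, hx₁, ha⟩ := hV0
  set a := V x₁ with ha_def
  have hVτ : ∀ x ∈ frontier Ω, ∀ τ, ⟪τ, T.normal x⟫ = 0 → fderiv ℝ V x τ = 0 := by
    intro x hx τ hτ
    have h := T.fderiv_extMain hV hx τ
    rw [hcon x hx, T.fderiv_proj_tangent hx hτ, T.fderiv_sdist_tangent hx hτ] at h
    simpa using h.symm
  have hS0 : IsCompact (frontier Ω ∩ V ⁻¹' {a}) :=
    (isCompact_frontier hb).inter_right (isClosed_singleton.preimage hV.continuous)
  obtain ⟨x₀, ⟨hx₀, hVx₀⟩, hmax⟩ := hS0.exists_isMaxOn ⟨x₁, hx₁, rfl⟩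
    (f := fun x => ⟪a, x⟫) (by fun_prop)
  rw [mem_preimage, mem_singleton_iff] at hVx₀
  obtain ⟨r, hr, hball⟩ := Metric.isOpen_iff.1 T.isOpen_dom x₀ (T.mem_dom_self hx₀)
  have hconst : ∀ y ∈ Metric.ball x₀ r, V (T.proj y) = a := by
    intro y hy
    have hdiff : ∀ z, HasFDerivAt (fun y => V (T.proj y))
      ((fderiv ℝ V (T.proj z)).comp (fderiv ℝ T.proj z)) z := fun z =>
        T.hasFDerivAt_comp_proj (hV.differentiable (by simp) _)
    have := Metric.isOpen_ball.is_const_of_fderiv_eq_zero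
      (convex_ball x₀ r).isPreconnected (f := fun y => V (T.proj y))
      (fun z _ => (hdiff z).differentiableAt.differentiableWithinAt) (fun z hz => by
        rw [(hdiff z).fderiv]
        ext1 ξ
        exact hVτ _ (T.proj_mem z (hball hz)) _ (T.inner_fderiv_proj z (hball hz) ξ))
      hy (Metric.mem_ball_self hr)
    rw [this, T.proj_self hx₀, hVx₀]
  have hloc : IsLocalMax (fun y => ⟪a, T.proj y⟫) x₀ := by
    filter_upwards [Metric.ball_mem_nhds x₀ hr] with y hy
    have h := hmax ⟨T.proj_mem y (hball hy), hconst y hy⟩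
    simpa [T.proj_self hx₀] using h
  have hder : HasFDerivAt (fun y => ⟪a, T.proj y⟫)
      ((innerSL ℝ a).comp (fderiv ℝ T.proj x₀)) x₀ :=
    (innerSL ℝ a).hasFDerivAt.comp x₀ (T.hasFDerivAt_proj x₀)
  have h0 := congrArg (fun L => L a) (hloc.hasFDerivAt_eq_zero hder)
  have hat : ⟪a, T.normal x₀⟫ = 0 := by rw [← hVx₀]; exact hVt x₀ hx₀
  simp [T.fderiv_proj_tangent hx₀ hat] at h0
  exact ha h0

end TubularCoords

/-! ### Volume of thin layers -/

theorem add_smul_mem_ball {x e : Rn n} (he : ‖e‖ = 1) {r s τ : ℝ} {z : Rn n}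
    (hz : z ∈ Metric.ball x r) (h : r + |τ| ≤ s) : z + τ • e ∈ Metric.ball x s := by
  rw [Metric.mem_ball, dist_eq_norm] at hz ⊢
  calc ‖z + τ • e - x‖ = ‖(z - x) + τ • e‖ := by congr 1; abel
    _ ≤ ‖z - x‖ + ‖τ • e‖ := norm_add_le _ _
    _ < s := by rw [norm_smul, he, mul_one, Real.norm_eq_abs]; linarith

/-- If the derivative of `d` in the direction `e` is between `1/2` and `2` in a convex set, then
`d` grows accordingly along `e`. -/
theorem line_growth {d : Rn n → ℝ} (hd : Differentiable ℝ d) {e : Rn n} {B : Set (Rn n)}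
    (hB : Convex ℝ B) (hlo : ∀ z ∈ B, 1 / 2 ≤ fderiv ℝ d z e) (hhi : ∀ z ∈ B, fderiv ℝ d z e ≤ 2)
    {z : Rn n} {τ : ℝ} (hτ : 0 ≤ τ) (hz : z ∈ B) (hz' : z + τ • e ∈ B) :
    τ / 2 ≤ d (z + τ • e) - d z ∧ d (z + τ • e) - d z ≤ 2 * τ := by
  rcases hτ.eq_or_lt with rfl | hτ
  · simp
  have hmem : ∀ s ∈ Icc 0 τ, z + s • e ∈ B := by
    intro s hs
    have h := hB.add_smul_sub_mem hz hz' (t := s / τ)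
      ⟨div_nonneg hs.1 hτ.le, (div_le_one hτ).2 hs.2⟩
    rwa [add_sub_cancel_left, smul_smul, div_mul_cancel₀ _ hτ.ne'] at h
  have hder : ∀ s : ℝ, HasDerivAt (fun s : ℝ => d (z + s • e)) (fderiv ℝ d (z + s • e) e) s :=
    fun s => hasDerivAt_line (hd _)
  obtain ⟨s, hs, h⟩ := exists_hasDerivAt_eq_slope (fun s : ℝ => d (z + s • e)) _ hτ
    (fun s _ => (hder s).continuousAt.continuousWithinAt) (fun s _ => hder s)
  rw [eq_div_iff (by linarith)] at h
  simp only [sub_zero, zero_smul, add_zero] at h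
  have hs' := hmem s (Ioo_subset_Icc_self hs)
  rw [← h]
  constructor <;> nlinarith [hlo _ hs', hhi _ hs']

theorem exists_ball_fderiv_bounds {d : Rn n → ℝ} (hd : ContDiff ℝ ∞ d) {x e : Rn n}
    (hde : fderiv ℝ d x e = 1) : ∃ r > 0, ∀ z ∈ Metric.ball x r,
      1 / 2 ≤ fderiv ℝ d z e ∧ fderiv ℝ d z e ≤ 2 := by
  have hc : Continuous fun z => fderiv ℝ d z e :=
    (hd.continuous_fderiv (by simp)).clm_apply continuous_const
  have h : ∀ᶠ z in 𝓝 x, fderiv ℝ d z e ∈ Icc (1 / 2 : ℝ) 2 :=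
    hc.continuousAt.eventually (by simp only [hde]; exact Icc_mem_nhds (by norm_num) (by norm_num))
  exact Metric.eventually_nhds_iff_ball.1 h

/-- About `r / (4s)` translates of the layer along `e` are pairwise disjoint and stay in a ball of
radius `2r`, so each has volume `O(s)`. -/
theorem volume_layer_le {d : Rn n → ℝ} (hd : ContDiff ℝ ∞ d) {x e : Rn n} (he : ‖e‖ = 1)
    (hde : fderiv ℝ d x e = 1) : ∃ r > 0, ∃ C : ℝ, ∀ s : ℝ, 0 < s → s < r →
      volume.real (Metric.ball x r ∩ {z | |d z| < s}) ≤ C * s := by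
  obtain ⟨r, hr, hder⟩ := exists_ball_fderiv_bounds hd hde
  have hdiff : Differentiable ℝ d := hd.differentiable (by simp)
  -- The second summand pays for the rounding in `r < 4s(m + 1)`.
  refine ⟨r, hr, 8 * volume.real (Metric.ball x (2 * r)) / r + 8 *
    volume.real (Metric.ball x r) / r, fun s hs hsr => ?_⟩
  set A := Metric.ball x r ∩ {z | |d z| < s} with hA
  have hAo : IsOpen A := Metric.isOpen_ball.inter
    (isOpen_lt (continuous_abs.comp hd.continuous) continuous_const)
  have hAfin : volume A ≠ ⊤ := measure_ne_top_of_subset inter_subset_left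
    measure_ball_lt_top.ne
  set m := ⌊r / (4 * s)⌋₊ with hm
  have hm' : (m : ℝ) * (4 * s) ≤ r := by
    rw [← le_div_iff₀ (by positivity)]; exact Nat.floor_le (by positivity)
  let B : ℕ → Set (Rn n) := fun k => (fun z => (-((4 * s * k) • e)) + z) ⁻¹' A
  have hBm : ∀ k, MeasurableSet (B k) := fun k =>
    hAo.measurableSet.preimage (measurable_const_add _)
  have hBv : ∀ k, volume.real (B k) = volume.real A := fun k => by
    simp only [Measure.real, B, measure_preimage_add]
  -- A shift by at least `4s` raises `d` by at least `2s`, which cannot happen between two values in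
  -- `(-s, s)`.
  have key : ∀ k k' : ℕ, k < k' → Disjoint (B k) (B k') := by
    intro k k' hkk
    rw [Set.disjoint_left]
    intro z hz hz'
    have hk1 : (1 : ℝ) ≤ (k' : ℝ) - k := by
      have : (k : ℝ) + 1 ≤ k' := mod_cast hkk
      linarith
    simp only [B, mem_preimage] at hz hz'
    have e1 : -((4 * s * (k : ℝ)) • e) + z = (-((4 * s * (k' : ℝ)) • e) + z) +
        (4 * s * ((k' : ℝ) - k)) • e := by
      rw [mul_sub, sub_smul]; abel
    have hg := line_growth hdiff (convex_ball x r) (fun z hz => (hder z hz).1)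
      (fun z hz => (hder z hz).2) (z := -((4 * s * (k' : ℝ)) • e) + z)
      (τ := 4 * s * ((k' : ℝ) - k)) (by nlinarith) hz'.1 (by rw [← e1]; exact hz.1)
    rw [← e1] at hg
    have h1 : |d _| < s := hz.2
    have h2 : |d _| < s := hz'.2
    rw [abs_lt] at h1 h2
    nlinarith [hg.1]
  have hdisj : Set.PairwiseDisjoint (↑(Finset.range m)) B := by
    intro k _ k' _ hne
    rcases lt_or_gt_of_ne hne with h | h
    · exact key k k' h
    · exact (key k' k h).symm
  have hsub : ⋃ k ∈ Finset.range m, B k ⊆ Metric.ball x (2 * r) := by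
    refine iUnion₂_subset fun k hk z hz => ?_
    have hkm : (k : ℝ) ≤ m := mod_cast (Finset.mem_range.1 hk).le
    have h := add_smul_mem_ball he (τ := 4 * s * k) (s := 2 * r) hz.1 (by
      rw [abs_of_nonneg (by positivity)]; nlinarith)
    change -((4 * s * (k : ℝ)) • e) + z + (4 * s * (k : ℝ)) • e ∈ _ at h
    rwa [neg_add_eq_sub, sub_add_cancel] at h
  have hvol : (m : ℝ) * volume.real A ≤ volume.real (Metric.ball x (2 * r)) := by
    have h1 := measureReal_mono (μ := volume) hsub measure_ball_lt_top.ne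
    rw [measureReal_biUnion_finset hdisj (fun k _ => hBm k) (fun k _ => by
      simp only [B, measure_preimage_add]; exact hAfin)] at h1
    simpa [hBv] using h1
  have hA0 : 0 ≤ volume.real A := measureReal_nonneg
  have hm2 : r / (4 * s) < m + 1 := Nat.lt_floor_add_one _
  rw [div_lt_iff₀ (by positivity)] at hm2
  have hAr : volume.real A ≤ volume.real (Metric.ball x r) :=
    measureReal_mono inter_subset_left measure_ball_lt_top.ne
  have h3 : volume.real A * r ≤ (8 * volume.real (Metric.ball x (2 * r)) +
      8 * volume.real (Metric.ball x r)) * s := by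
    nlinarith [mul_le_mul_of_nonneg_left hm2.le hA0, mul_le_mul_of_nonneg_right hvol hs.le,
      mul_le_mul_of_nonneg_right hAr hs.le]
  rw [← add_div, div_mul_eq_mul_div, le_div_iff₀ hr]
  exact h3

/-- Conversely, `O(1/s)` translates of the layer along `e` cover a fixed ball, so each has volume at
least a multiple of `s`. -/
theorem le_volume_layer {d : Rn n → ℝ} (hd : ContDiff ℝ ∞ d) {x e : Rn n} (he : ‖e‖ = 1)
    (hde : fderiv ℝ d x e = 1) (hx : d x = 0) {R : ℝ} (hR : 0 < R) :
    ∃ s₀ > 0, ∃ c > (0 : ℝ), ∀ s : ℝ, 0 < s → s < s₀ →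
      c * s ≤ volume.real (Metric.ball x R ∩ {z | |d z| < s}) := by
  obtain ⟨r₁, hr₁, hder⟩ := exists_ball_fderiv_bounds hd hde
  have hdiff : Differentiable ℝ d := hd.differentiable (by simp)
  set r := min r₁ R with hrdef
  have hr : 0 < r := lt_min hr₁ hR
  have hsub : Metric.ball x r ⊆ Metric.ball x r₁ := Metric.ball_subset_ball (min_le_left _ _)
  have hgrow : ∀ z τ, 0 ≤ τ → z ∈ Metric.ball x r → z + τ • e ∈ Metric.ball x r →
      τ / 2 ≤ d (z + τ • e) - d z ∧ d (z + τ • e) - d z ≤ 2 * τ := fun z τ hτ hz hz' =>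
    line_growth hdiff (convex_ball x r) (fun z hz => (hder z (hsub hz)).1)
      (fun z hz => (hder z (hsub hz)).2) hτ hz hz'
  have hsmall : ∀ᶠ z in 𝓝 x, |d z| < r / 8 := by
    have hc : Continuous fun z => |d z| := hd.continuous.abs
    exact hc.continuousAt.eventually (gt_mem_nhds (by simp only [hx, abs_zero]; positivity))
  obtain ⟨r₂, hr₂, hsmall⟩ := Metric.eventually_nhds_iff_ball.1 hsmall
  set r' := min r₂ (r / 4) with hr'def
  have hr' : 0 < r' := lt_min hr₂ (by positivity)
  have hr'4 : r' ≤ r / 4 := min_le_right _ _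
  set v := volume.real (Metric.ball x r') with hv
  have hvpos : 0 < v := ENNReal.toReal_pos (Metric.measure_ball_pos _ _ hr').ne'
    measure_ball_lt_top.ne
  refine ⟨r, hr, v / (9 * r), by positivity, fun s hs hsr => ?_⟩
  set A := Metric.ball x R ∩ {z | |d z| < s} with hA
  have hAfin : volume A ≠ ⊤ := measure_ne_top_of_subset inter_subset_left
    measure_ball_lt_top.ne
  set M : ℕ := ⌈2 * r / s⌉₊ with hM
  have hM1 : 2 * r / s ≤ M := Nat.le_ceil _
  have hM2 : (M : ℝ) < 2 * r / s + 1 := Nat.ceil_lt_add_one (by positivity)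
  -- The shifts start at `-r/4` and advance by `s/4`; with `M ≥ 2r/s` they reach `r/4`.
  let y : ℕ → Rn n := fun k => (-(r / 4) + s / 4 * k) • e
  let B : ℕ → Set (Rn n) := fun k => (fun z => y k + z) ⁻¹' A
  have hBv : ∀ k, volume.real (B k) = volume.real A := fun k => by
    simp only [Measure.real, B, measure_preimage_add]
  have hcov : Metric.ball x r' ⊆ ⋃ k ∈ Finset.range (M + 1), B k := by
    intro z hz
    have hzr : ∀ τ : ℝ, |τ| ≤ r / 2 → z + τ • e ∈ Metric.ball x r := fun τ hτ =>
      add_smul_mem_ball he hz (by linarith)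
    have hdz := abs_lt.1 (hsmall z (Metric.ball_subset_ball (min_le_left _ _) hz))
    have hz0 : z ∈ Metric.ball x r := by simpa using hzr 0 (by simp; positivity)
    have hplus := (hgrow z (r / 4) (by positivity) hz0
      (hzr _ (by rw [abs_of_pos (by positivity)]; linarith))).1
    have hminus := (hgrow (z + (-(r / 4)) • e) (r / 4) (by positivity)
      (hzr _ (by rw [abs_neg, abs_of_pos (by positivity)]; linarith))
      (by rw [add_assoc, ← add_smul]; simpa using hz0)).1
    rw [add_assoc, ← add_smul, neg_add_cancel, zero_smul, add_zero] at hminus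
    have hcont : Continuous fun τ : ℝ => d (z + τ • e) := hd.continuous.comp (by fun_prop)
    -- Since `|d z| < r/8` and `d` gains at least `r/8` over a length `r/4`, it has a zero on this
    -- segment. The grid shift just below that zero is within `s/4`, so `|d| ≤ s/2` there.
    obtain ⟨τ, hτ, hτ0⟩ := intermediate_value_Icc (a := -(r / 4)) (b := r / 4) (by linarith)
      hcont.continuousOn (show (0 : ℝ) ∈ Icc _ _ from ⟨by linarith, by linarith⟩)
    simp only at hτ0
    set k := ⌊(τ + r / 4) / (s / 4)⌋₊ with hk
    have hq : 0 ≤ (τ + r / 4) / (s / 4) := div_nonneg (by linarith [hτ.1]) (by positivity)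
    have hk1 : (k : ℝ) ≤ (τ + r / 4) / (s / 4) := Nat.floor_le hq
    have hk2 : (τ + r / 4) / (s / 4) < k + 1 := Nat.lt_floor_add_one _
    rw [le_div_iff₀ (by positivity)] at hk1
    rw [div_lt_iff₀ (by positivity)] at hk2
    have hkM : k < M + 1 := by
      have : (k : ℝ) ≤ M := by
        refine le_trans ?_ hM1
        rw [le_div_iff₀ hs]
        nlinarith [hτ.2]
      exact Nat.lt_succ_of_le (mod_cast this)
    refine mem_iUnion₂.2 ⟨k, Finset.mem_range.2 hkM, ?_⟩
    set σ := -(r / 4) + s / 4 * k with hσ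
    have hσ1 : σ ≤ τ := by rw [hσ]; linarith
    have hσ2 : τ - σ ≤ s / 4 := by rw [hσ]; linarith
    have hσr : |σ| ≤ r / 2 := by
      rw [abs_le]
      have : 0 ≤ s / 4 * k := by positivity
      constructor
      · rw [hσ]; linarith
      · linarith [hτ.2]
    have hτr : |τ| ≤ r / 2 := by
      rw [abs_le]; constructor <;> linarith [hτ.1, hτ.2]
    have e1 : (z + σ • e) + (τ - σ) • e = z + τ • e := by rw [sub_smul]; abel
    have hg := hgrow (z + σ • e) (τ - σ) (by linarith) (hzr σ hσr) (by rw [e1]; exact hzr τ hτr)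
    rw [e1, hτ0] at hg
    have hmem : z + σ • e ∈ A := by
      refine ⟨Metric.ball_subset_ball (min_le_right _ _) (hzr σ hσr), ?_⟩
      change |d (z + σ • e)| < s
      rw [abs_lt]
      constructor <;> linarith [hg.1, hg.2]
    change y k + z ∈ A
    rwa [add_comm]
  have h1 : v ≤ ((M : ℝ) + 1) * volume.real A := by
    calc v ≤ volume.real (⋃ k ∈ Finset.range (M + 1), B k) := by
          refine measureReal_mono hcov ?_
          refine ((measure_biUnion_finset_le _ _).trans_lt
            (ENNReal.sum_lt_top.2 fun k _ => ?_)).ne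
          simp only [B, measure_preimage_add]
          exact hAfin.lt_top
      _ ≤ ∑ k ∈ Finset.range (M + 1), volume.real (B k) := measureReal_biUnion_finset_le _ _
      _ = _ := by simp [hBv]
  have h2 : ((M : ℝ) + 1) * s ≤ 9 * r := by
    have : (M : ℝ) * s < 2 * r + s := by
      calc (M : ℝ) * s < (2 * r / s + 1) * s := by gcongr
        _ = 2 * r + s := by field_simp
    linarith
  rw [div_mul_eq_mul_div, div_le_iff₀ (by positivity)]
  calc v * s ≤ (((M : ℝ) + 1) * volume.real A) * s := by gcongr
    _ = volume.real A * (((M : ℝ) + 1) * s) := by ring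
    _ ≤ volume.real A * (9 * r) := by gcongr

/-! ### Geometry of thin shells -/

theorem shell_congr {Ω : Set (Rn n)} {a a' b b' : Rn n → ℝ} (ha : EqOn a a' (frontier Ω))
    (hb : EqOn b b' (frontier Ω)) : shell Ω a b = shell Ω a' b' := by
  ext z
  constructor
  · rintro ⟨x, hx, t, h1, h2, h3⟩
    exact ⟨x, hx, t, by rwa [← ha hx], by rwa [← hb hx], h3⟩
  · rintro ⟨x, hx, t, h1, h2, h3⟩
    exact ⟨x, hx, t, by rwa [ha hx], by rwa [hb hx], h3⟩

theorem isOuterNormal_of_sign {U : Set (Rn n)} {ρ : Rn n → ℝ} {z w : Rn n}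
    (hρ : ContDiff ℝ ∞ ρ) (hw : fderiv ℝ ρ z w ≠ 0) (h : ∀ᶠ y in 𝓝 z, y ∈ U ↔ ρ y < 0) :
    IsOuterNormal U z (‖gradient ρ z‖⁻¹ • gradient ρ z) := by
  refine ⟨ρ, hρ, fun h0 => hw ?_, h, rfl⟩
  rw [← inner_gradient_left, h0, inner_zero_left]

theorem inner_outerNormal_eq_zero_iff {U : Set (Rn n)} {ρ : Rn n → ℝ} {z w : Rn n}
    (hz : z ∈ frontier U) (hρ : ContDiff ℝ ∞ ρ) (hw : fderiv ℝ ρ z w ≠ 0)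
    (h : ∀ᶠ y in 𝓝 z, y ∈ U ↔ ρ y < 0) (u : Rn n) :
    ⟪u, outerNormal U z⟫ = 0 ↔ fderiv ℝ ρ z u = 0 := by
  have h0 : gradient ρ z ≠ 0 := fun h0 => hw (by
    rw [← inner_gradient_left, h0, inner_zero_left])
  rw [outerNormal_eq hz (isOuterNormal_of_sign hρ hw h), inner_smul_right, mul_eq_zero,
    real_inner_comm, inner_gradient_left]
  simp [h0]

namespace TubularCoords

variable {Ω : Set (Rn n)} (T : TubularCoords Ω)

/-- The compact tube `{x + t n(x) : x ∈ ∂Ω, |t| ≤ width}`. -/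
def tube : Set (Rn n) :=
  (fun p : Rn n × ℝ => p.1 + p.2 • T.normal p.1) '' (frontier Ω ×ˢ Icc (-T.width) T.width)

theorem continuous_normalMap : Continuous fun p : Rn n × ℝ => p.1 + p.2 • T.normal p.1 :=
  continuous_fst.add (continuous_snd.smul (T.normal_smooth.continuous.comp continuous_fst))

theorem isCompact_tube (hb : Bornology.IsBounded Ω) : IsCompact T.tube :=
  ((isCompact_frontier hb).prod isCompact_Icc).image T.continuous_normalMap

theorem mem_tube {x : Rn n} (hx : x ∈ frontier Ω) {t : ℝ} (ht : |t| ≤ T.width) :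
    x + t • T.normal x ∈ T.tube := ⟨(x, t), ⟨hx, abs_le.1 ht⟩, rfl⟩

/-- `a` is smooth, positive on the hypersurface, and smaller than the width there. -/
structure IsThin (T : TubularCoords Ω) (a : Rn n → ℝ) : Prop where
  smooth : ContDiff ℝ ∞ a
  pos : ∀ x ∈ frontier Ω, 0 < a x
  lt : ∀ x ∈ frontier Ω, a x < T.width

variable {T} {a b : Rn n → ℝ}

theorem IsThin.contDiff_comp (ha : T.IsThin a) : ContDiff ℝ ∞ fun z => a (T.proj z) :=
  ha.smooth.comp T.proj_smooth

theorem IsThin.abs_lt (ha : T.IsThin a) {x : Rn n} (hx : x ∈ frontier Ω) : |a x| < T.width := by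
  rw [abs_of_pos (ha.pos x hx)]; exact ha.lt x hx

theorem IsThin.abs_neg_lt (ha : T.IsThin a) {x : Rn n} (hx : x ∈ frontier Ω) :
    |-a x| < T.width := by rw [abs_neg]; exact ha.abs_lt hx

theorem abs_lt_width (ha : T.IsThin a) (hb : T.IsThin b) {x : Rn n} (hx : x ∈ frontier Ω)
    {t : ℝ} (h1 : -a x ≤ t) (h2 : t ≤ b x) : |t| < T.width :=
  _root_.abs_lt.2 ⟨by linarith [ha.lt x hx], by linarith [hb.lt x hx]⟩

theorem shell_eq (ha : T.IsThin a) (hb : T.IsThin b) :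
    shell Ω a b = T.dom ∩ {z | -a (T.proj z) < T.sdist z ∧ T.sdist z < b (T.proj z)} := by
  ext z
  constructor
  · rintro ⟨x, hx, t, h1, h2, rfl⟩
    have ht := (abs_lt_width ha hb hx h1.le h2.le).le
    rw [← T.normal_eq x hx]
    refine ⟨T.mem_dom x hx t ht, ?_⟩
    simp only [mem_ofPred_eq, T.proj_eq x hx t ht, T.sdist_eq x hx t ht]
    exact ⟨h1, h2⟩
  · rintro ⟨hz, h1, h2⟩
    refine ⟨T.proj z, T.proj_mem z hz, T.sdist z, h1, h2, ?_⟩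
    rw [← T.normal_eq _ (T.proj_mem z hz), T.recon z hz]

theorem isOpen_shell (ha : T.IsThin a) (hb : T.IsThin b) : IsOpen (shell Ω a b) := by
  rw [shell_eq ha hb]
  exact T.isOpen_dom.inter
    ((isOpen_lt ha.contDiff_comp.continuous.neg T.sdist_smooth.continuous).inter
      (isOpen_lt T.sdist_smooth.continuous hb.contDiff_comp.continuous))

/-- The coordinates are valid only on the open set `dom`, so closedness comes from intersecting the
weak inequalities with the compact tube. -/
theorem exists_of_mem_closure_shell (hΩ : Bornology.IsBounded Ω) (ha : T.IsThin a)
    (hb : T.IsThin b) {z : Rn n} (hz : z ∈ closure (shell Ω a b)) :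
    ∃ x ∈ frontier Ω, ∃ t : ℝ, -a x ≤ t ∧ t ≤ b x ∧ z = x + t • T.normal x := by
  have hcl : IsClosed (T.tube ∩ {z | -a (T.proj z) ≤ T.sdist z ∧ T.sdist z ≤ b (T.proj z)}) :=
    (T.isCompact_tube hΩ).isClosed.inter
      ((isClosed_le ha.contDiff_comp.continuous.neg T.sdist_smooth.continuous).inter
        (isClosed_le T.sdist_smooth.continuous hb.contDiff_comp.continuous))
  have hsub : shell Ω a b ⊆
      T.tube ∩ {z | -a (T.proj z) ≤ T.sdist z ∧ T.sdist z ≤ b (T.proj z)} := by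
    rintro _ ⟨x, hx, t, h1, h2, rfl⟩
    have ht := (abs_lt_width ha hb hx h1.le h2.le).le
    rw [← T.normal_eq x hx]
    refine ⟨T.mem_tube hx ht, ?_⟩
    simp only [mem_ofPred_eq, T.proj_eq x hx t ht, T.sdist_eq x hx t ht]
    exact ⟨h1.le, h2.le⟩
  obtain ⟨⟨⟨x, t⟩, ⟨hx, ht⟩, rfl⟩, h⟩ := closure_minimal hsub hcl hz
  have ht' : |t| ≤ T.width := abs_le.2 ht
  simp only [mem_ofPred_eq, T.proj_eq x hx t ht', T.sdist_eq x hx t ht'] at h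
  exact ⟨x, hx, t, h.1, h.2, rfl⟩

theorem mem_closure_shell (ha : T.IsThin a) (hb : T.IsThin b) {x : Rn n} (hx : x ∈ frontier Ω)
    {t : ℝ} (h1 : -a x ≤ t) (h2 : t ≤ b x) : x + t • T.normal x ∈ closure (shell Ω a b) := by
  have hlt : -a x < b x := by linarith [ha.pos x hx, hb.pos x hx]
  have hcl : t ∈ closure (Ioo (-a x) (b x)) := by
    rw [closure_Ioo hlt.ne]; exact ⟨h1, h2⟩
  have hc : Continuous fun t : ℝ => x + t • T.normal x := by fun_prop
  refine (image_closure_subset_closure_image hc).trans (closure_mono ?_) ⟨t, hcl, rfl⟩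
  rintro _ ⟨s, hs, rfl⟩
  exact ⟨x, hx, s, hs.1, hs.2, by rw [T.normal_eq x hx]⟩

theorem notMem_shell (ha : T.IsThin a) (hb : T.IsThin b) {x : Rn n} (hx : x ∈ frontier Ω)
    {t : ℝ} (ht : |t| ≤ T.width) (h : t = -a x ∨ t = b x) :
    x + t • T.normal x ∉ shell Ω a b := by
  rw [shell_eq ha hb]
  rintro ⟨-, h'⟩
  simp only [mem_ofPred_eq, T.proj_eq x hx t ht, T.sdist_eq x hx t ht] at h'
  rcases h with h | h <;> linarith [h'.1, h'.2]

theorem frontier_shell (hΩ : Bornology.IsBounded Ω) (ha : T.IsThin a) (hb : T.IsThin b) :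
    frontier (shell Ω a b) = (fun x => x + (-a x) • T.normal x) '' frontier Ω ∪
      (fun x => x + b x • T.normal x) '' frontier Ω := by
  rw [(isOpen_shell ha hb).frontier_eq]
  ext z
  constructor
  · rintro ⟨hz, hz'⟩
    obtain ⟨x, hx, t, h1, h2, rfl⟩ := exists_of_mem_closure_shell hΩ ha hb hz
    rcases h1.eq_or_lt with h1 | h1
    · exact Or.inl ⟨x, hx, by simp only [h1]⟩
    rcases h2.eq_or_lt with h2 | h2
    · exact Or.inr ⟨x, hx, by simp only [h2]⟩
    · exact absurd ⟨x, hx, t, h1, h2, by rw [T.normal_eq x hx]⟩ hz'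
  · have hlt : ∀ x ∈ frontier Ω, -a x < b x := fun x hx => by
      linarith [ha.pos x hx, hb.pos x hx]
    rintro (⟨x, hx, rfl⟩ | ⟨x, hx, rfl⟩)
    · exact ⟨mem_closure_shell ha hb hx le_rfl (hlt x hx).le,
        notMem_shell ha hb hx (ha.abs_neg_lt hx).le (Or.inl rfl)⟩
    · exact ⟨mem_closure_shell ha hb hx (hlt x hx).le le_rfl,
        notMem_shell ha hb hx (hb.abs_lt hx).le (Or.inr rfl)⟩

/-! ### Defining functions and normals of the two boundary graphs -/

theorem hasFDerivAt_thin_comp (ha : T.IsThin a) (z : Rn n) :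
    HasFDerivAt (fun y => a (T.proj y)) ((fderiv ℝ a (T.proj z)).comp (fderiv ℝ T.proj z)) z :=
  T.hasFDerivAt_comp_proj (ha.smooth.differentiable (by simp) _)

theorem fderiv_upper (hb : T.IsThin b) {x : Rn n} (hx : x ∈ frontier Ω) (w : Rn n) :
    fderiv ℝ (fun z => T.sdist z - b (T.proj z)) (x + b x • T.normal x) w =
      fderiv ℝ T.sdist (x + b x • T.normal x) w -
        fderiv ℝ b x (fderiv ℝ T.proj (x + b x • T.normal x) w) := by
  rw [HasFDerivAt.fderiv (f := fun z => T.sdist z - b (T.proj z))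
    ((T.hasFDerivAt_sdist _).sub (hasFDerivAt_thin_comp hb _))]
  simp [T.proj_eq x hx _ (hb.abs_lt hx).le]

theorem fderiv_lower (ha : T.IsThin a) {x : Rn n} (hx : x ∈ frontier Ω) (w : Rn n) :
    fderiv ℝ (fun z => -T.sdist z - a (T.proj z)) (x + (-a x) • T.normal x) w =
      -fderiv ℝ T.sdist (x + (-a x) • T.normal x) w -
        fderiv ℝ a x (fderiv ℝ T.proj (x + (-a x) • T.normal x) w) := by
  rw [HasFDerivAt.fderiv (f := fun z => -T.sdist z - a (T.proj z))
    ((T.hasFDerivAt_sdist _).neg.sub (hasFDerivAt_thin_comp ha _))]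
  simp only [sub_apply, neg_apply, ContinuousLinearMap.comp_apply,
    T.proj_eq x hx _ (ha.abs_neg_lt hx).le]

/-- At the upper graph the lower inequality is strict, hence persists nearby, and `t - b` alone
decides membership. -/
theorem upper_sign (ha : T.IsThin a) (hb : T.IsThin b) {x : Rn n} (hx : x ∈ frontier Ω) :
    ∀ᶠ y in 𝓝 (x + b x • T.normal x),
      y ∈ shell Ω a b ↔ (fun z => T.sdist z - b (T.proj z)) y < 0 := by
  have hbx := (hb.abs_lt hx).le
  have h1 : ∀ᶠ y in 𝓝 (x + b x • T.normal x), -a (T.proj y) < T.sdist y :=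
    (isOpen_lt ha.contDiff_comp.continuous.neg T.sdist_smooth.continuous).mem_nhds (by
      simp only [mem_ofPred_eq, Pi.neg_apply, T.proj_eq x hx _ hbx, T.sdist_eq x hx _ hbx]
      linarith [ha.pos x hx, hb.pos x hx])
  filter_upwards [h1, T.isOpen_dom.mem_nhds (T.mem_dom x hx _ hbx)] with y hy hyd
  rw [shell_eq ha hb]
  exact ⟨fun h => sub_neg.2 h.2.2, fun h => ⟨hyd, hy, sub_neg.1 h⟩⟩

theorem lower_sign (ha : T.IsThin a) (hb : T.IsThin b) {x : Rn n} (hx : x ∈ frontier Ω) :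
    ∀ᶠ y in 𝓝 (x + (-a x) • T.normal x),
      y ∈ shell Ω a b ↔ (fun z => -T.sdist z - a (T.proj z)) y < 0 := by
  have hax := (ha.abs_neg_lt hx).le
  have h1 : ∀ᶠ y in 𝓝 (x + (-a x) • T.normal x), T.sdist y < b (T.proj y) :=
    (isOpen_lt T.sdist_smooth.continuous hb.contDiff_comp.continuous).mem_nhds (by
      simp only [mem_ofPred_eq, T.proj_eq x hx _ hax, T.sdist_eq x hx _ hax]
      linarith [ha.pos x hx, hb.pos x hx])
  filter_upwards [h1, T.isOpen_dom.mem_nhds (T.mem_dom x hx _ hax)] with y hy hyd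
  rw [shell_eq ha hb]
  exact ⟨fun h => by have := h.2.1; linarith,
    fun h => ⟨hyd, by linarith, hy⟩⟩

theorem fderiv_upper_ne (hb : T.IsThin b) {x : Rn n} (hx : x ∈ frontier Ω) :
    fderiv ℝ (fun z => T.sdist z - b (T.proj z)) (x + b x • T.normal x) (T.normal x) ≠ 0 := by
  rw [fderiv_upper hb hx, T.fderiv_sdist_normal hx (hb.abs_lt hx),
    T.fderiv_proj_normal hx (hb.abs_lt hx)]
  simp

theorem fderiv_lower_ne (ha : T.IsThin a) {x : Rn n} (hx : x ∈ frontier Ω) :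
    fderiv ℝ (fun z => -T.sdist z - a (T.proj z)) (x + (-a x) • T.normal x) (T.normal x) ≠ 0 := by
  rw [fderiv_lower ha hx, T.fderiv_sdist_normal hx (ha.abs_neg_lt hx),
    T.fderiv_proj_normal hx (ha.abs_neg_lt hx)]
  simp

theorem hasSmoothBoundary_shell (hΩ : Bornology.IsBounded Ω) (ha : T.IsThin a)
    (hb : T.IsThin b) : HasSmoothBoundary (shell Ω a b) := by
  refine ⟨isOpen_shell ha hb, fun z hz => ?_⟩
  rw [frontier_shell hΩ ha hb] at hz
  rcases hz with ⟨x, hx, rfl⟩ | ⟨x, hx, rfl⟩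
  · exact ⟨_, isOuterNormal_of_sign (T.sdist_smooth.neg.sub ha.contDiff_comp)
      (fderiv_lower_ne ha hx) (lower_sign ha hb hx)⟩
  · exact ⟨_, isOuterNormal_of_sign (T.sdist_smooth.sub hb.contDiff_comp)
      (fderiv_upper_ne hb hx) (upper_sign ha hb hx)⟩

/-- The normal is a positive multiple of the gradient of `t - b(x)`. Tangency thus becomes a
relation between the two coordinate components of `w`, with no formula for the normal itself. -/
theorem inner_outerNormal_upper (hΩ : Bornology.IsBounded Ω) (ha : T.IsThin a)
    (hb : T.IsThin b) {x : Rn n} (hx : x ∈ frontier Ω) (w : Rn n) :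
    ⟪w, outerNormal (shell Ω a b) (x + b x • T.normal x)⟫ = 0 ↔
      fderiv ℝ T.sdist (x + b x • T.normal x) w -
        fderiv ℝ b x (fderiv ℝ T.proj (x + b x • T.normal x) w) = 0 := by
  rw [← fderiv_upper hb hx]
  refine inner_outerNormal_eq_zero_iff ?_ (T.sdist_smooth.sub hb.contDiff_comp)
    (fderiv_upper_ne hb hx) (upper_sign ha hb hx) w
  rw [frontier_shell hΩ ha hb]
  exact Or.inr ⟨x, hx, rfl⟩

theorem inner_outerNormal_lower (hΩ : Bornology.IsBounded Ω) (ha : T.IsThin a)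
    (hb : T.IsThin b) {x : Rn n} (hx : x ∈ frontier Ω) (w : Rn n) :
    ⟪w, outerNormal (shell Ω a b) (x + (-a x) • T.normal x)⟫ = 0 ↔
      -fderiv ℝ T.sdist (x + (-a x) • T.normal x) w -
        fderiv ℝ a x (fderiv ℝ T.proj (x + (-a x) • T.normal x) w) = 0 := by
  rw [← fderiv_lower ha hx]
  refine inner_outerNormal_eq_zero_iff ?_ (T.sdist_smooth.neg.sub ha.contDiff_comp)
    (fderiv_lower_ne ha hx) (lower_sign ha hb hx) w
  rw [frontier_shell hΩ ha hb]
  exact Or.inl ⟨x, hx, rfl⟩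

/-! #### The extended field on the closed shell -/

/-- `proj` and `sdist` recover `(x, t)`, so the pair is unique. The widths `a'`, `b'` need only
agree on `S` with thin ones, since the given data are smooth on `S` alone. -/
theorem normalCoord_eq (ha : T.IsThin a) (hb : T.IsThin b) {a' b' : Rn n → ℝ}
    (ea : EqOn a' a (frontier Ω)) (eb : EqOn b' b (frontier Ω))
    {x : Rn n} (hx : x ∈ frontier Ω)
    {t : ℝ} (h1 : -a x ≤ t) (h2 : t ≤ b x) :
    normalCoord Ω a' b' (x + t • outerNormal Ω x) = (x, t) := by
  have hinj : InjOn (fun p : Rn n × ℝ => p.1 + p.2 • outerNormal Ω p.1)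
      {p | p.1 ∈ frontier Ω ∧ -a' p.1 ≤ p.2 ∧ p.2 ≤ b' p.1} := by
    rintro ⟨y, s⟩ ⟨hy, hs1, hs2⟩ ⟨y', s'⟩ ⟨hy', hs1', hs2'⟩ h
    simp only [ea hy, eb hy, ea hy', eb hy', ← T.normal_eq _ hy, ← T.normal_eq _ hy']
      at hs1 hs2 hs1' hs2' h
    have hs := (abs_lt_width ha hb hy hs1 hs2).le
    have hs' := (abs_lt_width ha hb hy' hs1' hs2').le
    have e1 := congrArg T.proj h
    have e2 := congrArg T.sdist h
    rw [T.proj_eq y hy s hs, T.proj_eq y' hy' s' hs'] at e1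
    rw [T.sdist_eq y hy s hs, T.sdist_eq y' hy' s' hs'] at e2
    rw [e1, e2]
  exact hinj.leftInvOn_invFunOn (x := (x, t))
    ⟨hx, by simpa only [ea hx] using h1, by simpa only [eb hx] using h2⟩

theorem extValue_eq {g₂ G : Rn n → ℝ} {v V : Rn n → Rn n} (hG : ContDiff ℝ ∞ G)
    (eG : EqOn g₂ G (frontier Ω)) (eV : EqOn v V (frontier Ω))
    (hVt : ∀ y ∈ frontier Ω, ⟪V y, T.normal y⟫ = 0) (h : ℝ) {x : Rn n} (hx : x ∈ frontier Ω)
    {t : ℝ} (ht : |t| ≤ T.width) :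
    extValue Ω g₂ v h x t =
      T.extMain V (x + t • T.normal x) + h • T.extCorr G V (x + t • T.normal x) := by
  have hN : EqOn (outerNormal Ω) T.normal (frontier Ω) := fun y hy => (T.normal_eq y hy).symm
  rw [extValue, extMain, extCorr, T.proj_eq x hx t ht, T.sdist_eq x hx t ht, surfDeriv, eV hx,
    T.fderivWithin_eq hN hx (T.hasFDerivAt_normal x).differentiableAt (hVt x hx),
    T.inner_surfGrad eG hx (hG.differentiable (by simp) x) (hVt x hx), hN hx, smul_smul]

/-- In the coordinates `(x, t)` the extension is `(v, h ∂_v g₂)`, independent of `t`; both tangency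
conditions are read off from this. -/
theorem fderiv_proj_extValue {V : Rn n → Rn n} (hVt : ∀ y ∈ frontier Ω, ⟪V y, T.normal y⟫ = 0)
    {G : Rn n → ℝ} (h : ℝ) {x : Rn n} (hx : x ∈ frontier Ω) {t : ℝ} (ht : |t| < T.width) :
    fderiv ℝ T.proj (x + t • T.normal x)
      (T.extMain V (x + t • T.normal x) + h • T.extCorr G V (x + t • T.normal x)) = V x ∧
    fderiv ℝ T.sdist (x + t • T.normal x)
      (T.extMain V (x + t • T.normal x) + h • T.extCorr G V (x + t • T.normal x)) =
        h * fderiv ℝ G x (V x) := by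
  rw [extMain, extCorr, T.proj_eq x hx t ht.le, T.sdist_eq x hx t ht.le]
  constructor
  · rw [map_add, T.fderiv_proj_parallel hx ht (hVt x hx), map_smul, map_smul,
      T.fderiv_proj_normal hx ht]
    simp
  · rw [map_add, T.fderiv_sdist_parallel hx ht (hVt x hx), map_smul, map_smul,
      T.fderiv_sdist_normal hx ht]
    simp

end TubularCoords

/-! ### Sobolev fields given by smooth functions -/

/-- The Jacobian matrix of a vector field. -/
noncomputable def jac (W : Rn n → Rn n) (x : Rn n) : Matrix (Fin n) (Fin n) ℝ :=
  fun i j => partialDeriv j W x i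

theorem continuous_partialDeriv {F : Type*} [NormedAddCommGroup F] [NormedSpace ℝ F]
    {f : Rn n → F} (hf : ContDiff ℝ ∞ f) (j : Fin n) : Continuous (partialDeriv j f) :=
  (hf.continuous_fderiv (by simp)).clm_apply continuous_const

theorem contDiff_jac {W : Rn n → Rn n} (hW : ContDiff ℝ ∞ W) (i j : Fin n) :
    ContDiff ℝ ∞ fun x => jac W x i j := by
  have h : ContDiff ℝ ∞ (partialDeriv j W) :=
    (hW.fderiv_right (m := ∞) (by simp)).clm_apply contDiff_const
  exact (EuclideanSpace.proj (𝕜 := ℝ) i).contDiff.comp h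

theorem jac_eq_partialDeriv {W : Rn n → Rn n} (hW : ContDiff ℝ ∞ W) (x : Rn n) (i j : Fin n) :
    jac W x i j = partialDeriv j (fun y => W y i) x := by
  have h : HasFDerivAt (fun y => W y i)
      ((EuclideanSpace.proj (𝕜 := ℝ) i).comp (fderiv ℝ W x)) x :=
    (EuclideanSpace.proj (𝕜 := ℝ) i).hasFDerivAt.comp x
      (hW.differentiable (by simp) x).hasFDerivAt
  rw [partialDeriv, h.fderiv]
  rfl

theorem jac_add_smul {W₀ W₁ : Rn n → Rn n} (h₀ : ContDiff ℝ ∞ W₀) (h₁ : ContDiff ℝ ∞ W₁)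
    (h : ℝ) (x : Rn n) : jac (fun z => W₀ z + h • W₁ z) x = jac W₀ x + h • jac W₁ x := by
  ext i j
  have hd : HasFDerivAt (fun z => W₀ z + h • W₁ z) (fderiv ℝ W₀ x + h • fderiv ℝ W₁ x) x :=
    (h₀.differentiable (by simp) x).hasFDerivAt.add
      ((h₁.differentiable (by simp) x).hasFDerivAt.const_smul h)
  simp [jac, partialDeriv, hd.fderiv]

theorem memLp_of_continuous {F : Type*} [NormedAddCommGroup F] [SecondCountableTopology F]
    {f : Rn n → F} (hf : Continuous f) {U : Set (Rn n)}
    (hUm : MeasurableSet U) (hU : Bornology.IsBounded U) : MemLp f 2 (volume.restrict U) := by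
  obtain ⟨C, hC⟩ := hU.isCompact_closure.exists_bound_of_continuousOn hf.continuousOn
  have : IsFiniteMeasure (volume.restrict U) :=
    ⟨by rw [Measure.restrict_apply_univ]; exact hU.measure_lt_top⟩
  exact MemLp.of_bound hf.aestronglyMeasurable C
    (ae_restrict_of_forall_mem hUm fun x hx => hC x (subset_closure hx))

theorem integrableOn_of_continuous {f : Rn n → ℝ} (hf : Continuous f) {U : Set (Rn n)}
    (hU : Bornology.IsBounded U) : IntegrableOn f U :=
  (hf.continuousOn.integrableOn_compact hU.isCompact_closure).mono_set subset_closure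

theorem hasW12Grad_of_eqOn {U : Set (Rn n)} (hUm : MeasurableSet U)
    (hU : Bornology.IsBounded U) {u W : Rn n → Rn n} (hW : ContDiff ℝ ∞ W) (h : EqOn u W U) :
    HasW12Grad U u (jac W) := by
  refine ⟨?_, fun i j => memLp_of_continuous (contDiff_jac hW i j).continuous hUm hU, ?_⟩
  · exact (memLp_of_continuous hW.continuous hUm hU).ae_eq
      (ae_restrict_of_forall_mem hUm fun x hx => (h hx).symm)
  · intro φ hφ hφc hφU i j
    have hWi : ContDiff ℝ ∞ fun y => W y i :=
      (EuclideanSpace.proj (𝕜 := ℝ) i).contDiff.comp hW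
    have hφ0 : ∀ x ∉ U, φ x = 0 := fun x hx => image_eq_zero_of_notMem_tsupport
      fun hx' => hx (hφU hx')
    have hdφ0 : ∀ x ∉ tsupport φ, partialDeriv j φ x = 0 := fun x hx => by
      have : φ =ᶠ[𝓝 x] fun _ => 0 := by
        filter_upwards [(isClosed_tsupport φ).isOpen_compl.mem_nhds hx] with y hy
          using image_eq_zero_of_notMem_tsupport hy
      rw [partialDeriv, this.fderiv_eq]; simp
    have hdφc : HasCompactSupport (partialDeriv j φ) := HasCompactSupport.intro hφc hdφ0
    have hcφ := continuous_partialDeriv hφ j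
    have hcW := continuous_partialDeriv hWi j
    calc ∫ x in U, u x i * partialDeriv j φ x = ∫ x in U, W x i * partialDeriv j φ x :=
          setIntegral_congr_fun hUm fun x hx => by simp only [h hx]
      _ = ∫ x, W x i * partialDeriv j φ x :=
          setIntegral_eq_integral_of_forall_compl_eq_zero fun x hx => by
            rw [hdφ0 x fun hx' => hx (hφU hx'), mul_zero]
      _ = -∫ x, partialDeriv j (fun y => W y i) x * φ x :=
          integral_mul_fderiv_eq_neg_fderiv_mul_of_integrable
            ((hcW.mul hφ.continuous).integrable_of_hasCompactSupport hφc.mul_left)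
            ((hWi.continuous.mul hcφ).integrable_of_hasCompactSupport hdφc.mul_left)
            ((hWi.continuous.mul hφ.continuous).integrable_of_hasCompactSupport hφc.mul_left)
            (fun x _ => hWi.differentiable (by simp) x)
            (fun x _ => hφ.differentiable (by simp) x)
      _ = -∫ x in U, jac W x i j * φ x := by
          rw [setIntegral_eq_integral_of_forall_compl_eq_zero fun x hx => by
            rw [hφ0 x hx, mul_zero]]
          simp only [jac_eq_partialDeriv hW]

theorem hasZeroNormalTrace_of_eqOn {U : Set (Rn n)} (hUm : MeasurableSet U)
    {u W : Rn n → Rn n} (hW : ContDiff ℝ ∞ W) (h : EqOn u W U)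
    (hn : ∀ z ∈ frontier U, ⟪W z, outerNormal U z⟫ = 0) :
    HasZeroNormalTrace U u (jac W) := by
  -- The field agrees on `U` with a globally smooth one, so a constant approximating sequence works.
  refine ⟨fun _ => W, fun _ => hW, ?_, fun i j => ?_, ?_⟩
  · refine tendsto_const_nhds.congr fun k => Eq.symm ?_
    rw [eLpNorm_congr_ae (g := 0)
      (ae_restrict_of_forall_mem hUm fun x hx => sub_eq_zero.2 (h hx).symm), eLpNorm_zero]
  · refine tendsto_const_nhds.congr fun k => Eq.symm ?_
    rw [eLpNorm_congr_ae (g := 0) (Eventually.of_forall fun x => sub_self _), eLpNorm_zero]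
  · refine tendsto_const_nhds.congr fun k => Eq.symm ?_
    rw [eLpNorm_congr_ae (g := 0)
      (ae_restrict_of_forall_mem isClosed_frontier.measurableSet hn), eLpNorm_zero]

/-! ### Bounds on thin shells -/

namespace TubularCoords

variable {Ω : Set (Rn n)}

theorem exists_bound_of_eq_zero (T : TubularCoords Ω) (hb : Bornology.IsBounded Ω) {f : Rn n → ℝ}
    (hf : ContDiff ℝ ∞ f) (h0 : ∀ x ∈ frontier Ω, f x = 0) :
    ∃ L : ℝ, 0 ≤ L ∧ ∀ x ∈ frontier Ω, ∀ t : ℝ, |t| ≤ T.width →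
      |f (x + t • T.normal x)| ≤ L * |t| := by
  -- The mean value inequality is applied on a convex set, so the derivative is bounded on a ball
  -- containing the tube.
  obtain ⟨R, hR⟩ := (T.isCompact_tube hb).isBounded.subset_closedBall 0
  obtain ⟨L, hL⟩ := (isCompact_closedBall (0 : Rn n) R).exists_bound_of_continuousOn
    (hf.continuous_fderiv (by simp)).continuousOn
  refine ⟨max L 0, le_max_right _ _, fun x hx t ht => ?_⟩
  have hx' : x ∈ Metric.closedBall (0 : Rn n) R := hR (by
    simpa using T.mem_tube hx (t := 0) (by simpa using T.width_pos.le))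
  have h := (convex_closedBall (0 : Rn n) R).norm_image_sub_le_of_norm_fderiv_le
    (fun z _ => hf.differentiable (by simp) z) hL hx' (hR (T.mem_tube hx ht))
  rw [h0 x hx, sub_zero, add_sub_cancel_left, norm_smul, T.norm_normal x hx, mul_one,
    Real.norm_eq_abs, Real.norm_eq_abs] at h
  exact h.trans (mul_le_mul_of_nonneg_right (le_max_left _ _) (abs_nonneg _))

/-- The local bound of `volume_layer_le` is summed over finitely many pieces of `S` by compactness.
-/
theorem exists_volume_thin_le (T : TubularCoords Ω) (hb : Bornology.IsBounded Ω) :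
    ∃ C : ℝ, 0 ≤ C ∧ ∃ s₀ > 0, ∀ s : ℝ, 0 < s → s < s₀ →
      volume {z | ∃ x ∈ frontier Ω, ∃ t : ℝ, |t| < s ∧ z = x + t • T.normal x} ≤
        ENNReal.ofReal (C * s) := by
  have key : ∃ C : ℝ, 0 ≤ C ∧ ∃ s₀ > 0, ∀ s : ℝ, 0 < s → s < s₀ →
      volume {z | ∃ x ∈ frontier Ω ∩ frontier Ω, ∃ t : ℝ, |t| < s ∧ z = x + t • T.normal x} ≤
        ENNReal.ofReal (C * s) := by
    refine (isCompact_frontier hb).induction_on (p := fun A => ∃ C : ℝ, 0 ≤ C ∧ ∃ s₀ > 0,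
      ∀ s : ℝ, 0 < s → s < s₀ → volume {z | ∃ x ∈ frontier Ω ∩ A, ∃ t : ℝ, |t| < s ∧
        z = x + t • T.normal x} ≤ ENNReal.ofReal (C * s)) ?_ ?_ ?_ ?_
    · exact ⟨0, le_rfl, 1, one_pos, fun s _ _ => by simp⟩
    · rintro A B hAB ⟨C, hC, s₀, hs₀, h⟩
      refine ⟨C, hC, s₀, hs₀, fun s hs hs' => (measure_mono ?_).trans (h s hs hs')⟩
      rintro _ ⟨x, hx, t, ht, rfl⟩
      exact ⟨x, ⟨hx.1, hAB hx.2⟩, t, ht, rfl⟩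
    · rintro A B ⟨C, hC, s₀, hs₀, h⟩ ⟨C', hC', s₀', hs₀', h'⟩
      refine ⟨C + C', add_nonneg hC hC', min s₀ s₀', lt_min hs₀ hs₀', fun s hs hs' => ?_⟩
      rw [add_mul, ENNReal.ofReal_add (by positivity) (by positivity)]
      refine le_trans (measure_mono ?_) ((measure_union_le _ _).trans (add_le_add
        (h s hs (hs'.trans_le (min_le_left _ _))) (h' s hs (hs'.trans_le (min_le_right _ _)))))
      rintro _ ⟨x, ⟨hx, hx' | hx'⟩, t, ht, rfl⟩
      · exact Or.inl ⟨x, ⟨hx, hx'⟩, t, ht, rfl⟩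
      · exact Or.inr ⟨x, ⟨hx, hx'⟩, t, ht, rfl⟩
    · intro x hx
      have hd1 := T.fderiv_sdist_normal hx (t := 0) (by simpa using T.width_pos)
      rw [zero_smul, add_zero] at hd1
      obtain ⟨r, hr, C, hC⟩ := volume_layer_le T.sdist_smooth (T.norm_normal x hx) hd1
      -- Foot points in the half ball, moved by less than `r / 2`, remain in the ball where the
      -- layer estimate holds.
      refine ⟨Metric.ball x (r / 2), mem_nhdsWithin_of_mem_nhds (Metric.ball_mem_nhds _
        (by positivity)), max C 0, le_max_right _ _, min (r / 2) T.width,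
        lt_min (by positivity) T.width_pos, fun s hs hs' => ?_⟩
      have hsr : s < r / 2 := hs'.trans_le (min_le_left _ _)
      have hsw : s < T.width := hs'.trans_le (min_le_right _ _)
      have hsub : {z | ∃ y ∈ frontier Ω ∩ Metric.ball x (r / 2), ∃ t : ℝ, |t| < s ∧
          z = y + t • T.normal y} ⊆ Metric.ball x r ∩ {z | |T.sdist z| < s} := by
        rintro _ ⟨y, ⟨hy, hyb⟩, t, ht, rfl⟩
        refine ⟨add_smul_mem_ball (T.norm_normal y hy) hyb (by linarith), ?_⟩
        change |T.sdist _| < s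
        rwa [T.sdist_eq y hy t (ht.le.trans hsw.le)]
      refine (measure_mono hsub).trans ?_
      rw [← ENNReal.ofReal_toReal (measure_ne_top_of_subset inter_subset_left
        measure_ball_lt_top.ne)]
      exact ENNReal.ofReal_le_ofReal ((hC s hs (by linarith)).trans
        (mul_le_mul_of_nonneg_right (le_max_left _ _) hs.le))
  simpa only [inter_self] using key

/-! ### Symmetric parts, Frobenius norms and the two energy bounds -/

theorem symPart_apply (M : Matrix (Fin n) (Fin n) ℝ) (i j : Fin n) :
    symPart M i j = (M i j + M j i) / 2 := by
  simp [symPart]; ring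

/-- Polarisation: evaluate the quadratic form at `e_i + e_j`. -/
theorem symPart_jac_eq_zero {W : Rn n → Rn n} {x : Rn n}
    (h : ∀ ξ, ⟪fderiv ℝ W x ξ, ξ⟫ = 0) (i j : Fin n) : symPart (jac W x) i j = 0 := by
  have e : ∀ i j, jac W x i j =
      ⟪fderiv ℝ W x (EuclideanSpace.single j 1), EuclideanSpace.single i (1 : ℝ)⟫ := fun i j => by
    simp [jac, partialDeriv, EuclideanSpace.inner_single_right]
  have h1 := h (EuclideanSpace.single i 1 + EuclideanSpace.single j 1)
  rw [map_add, inner_add_left, inner_add_right, inner_add_right, h, h, ← e, ← e] at h1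
  rw [symPart_apply]
  linarith

theorem frobSq_nonneg (M : Matrix (Fin n) (Fin n) ℝ) : 0 ≤ frobSq M :=
  Finset.sum_nonneg fun _ _ => Finset.sum_nonneg fun _ _ => sq_nonneg _

theorem sq_apply_le_frobSq (M : Matrix (Fin n) (Fin n) ℝ) (i j : Fin n) :
    M i j ^ 2 ≤ frobSq M :=
  (Finset.single_le_sum (f := fun j => M i j ^ 2)
    (fun _ _ => sq_nonneg _) (Finset.mem_univ j)).trans
  (Finset.single_le_sum (f := fun i => ∑ j, M i j ^ 2)
    (fun _ _ => Finset.sum_nonneg fun _ _ => sq_nonneg _) (Finset.mem_univ i))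

theorem continuous_frobSq {M : Rn n → Matrix (Fin n) (Fin n) ℝ}
    (h : ∀ i j, Continuous fun x => M x i j) : Continuous fun x => frobSq (M x) :=
  continuous_finsetSum _ fun i _ => continuous_finsetSum _ fun j _ => (h i j).pow 2

theorem isBounded_shell (T : TubularCoords Ω) (hΩ : Bornology.IsBounded Ω) {a b : Rn n → ℝ} (ha : T.IsThin a)
    (hb : T.IsThin b) : Bornology.IsBounded (shell Ω a b) := by
  refine (T.isCompact_tube hΩ).isBounded.subset ?_
  rintro _ ⟨x, hx, t, h1, h2, rfl⟩
  rw [← T.normal_eq x hx]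
  exact T.mem_tube hx (abs_lt_width ha hb hx h1.le h2.le).le

theorem exists_pos_bound (hΩ : Bornology.IsBounded Ω) {g : Rn n → ℝ} (hg : Continuous g) :
    ∃ M > 0, ∀ x ∈ frontier Ω, g x ≤ M := by
  obtain ⟨M, hM⟩ := (isCompact_frontier hΩ).exists_bound_of_continuousOn hg.continuousOn
  exact ⟨max M 1, by positivity, fun x hx => (le_abs_self _).trans ((hM x hx).trans
    (le_max_left _ _))⟩

theorem exists_pos_lower_bound (hΩ : Bornology.IsBounded Ω) {g : Rn n → ℝ} (hg : Continuous g)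
    (hpos : ∀ x ∈ frontier Ω, 0 < g x) : ∃ m > 0, ∀ x ∈ frontier Ω, m ≤ g x := by
  rcases (frontier Ω).eq_empty_or_nonempty with h | h
  · exact ⟨1, one_pos, by simp [h]⟩
  · obtain ⟨x, hx, hmin⟩ := (isCompact_frontier hΩ).exists_isMinOn h hg.continuousOn
    exact ⟨g x, hpos x hx, fun y hy => hmin hy⟩

theorem eventually_isThin (T : TubularCoords Ω) (hΩ : Bornology.IsBounded Ω) {g : Rn n → ℝ} (hg : ContDiff ℝ ∞ g)
    (hpos : ∀ x ∈ frontier Ω, 0 < g x) :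
    ∀ᶠ h in 𝓝[>] (0 : ℝ), T.IsThin fun x => h * g x := by
  obtain ⟨M, hM, hgM⟩ := exists_pos_bound hΩ hg.continuous
  have : ∀ᶠ h in 𝓝[>] (0 : ℝ), h < T.width / M :=
    nhdsWithin_le_nhds (gt_mem_nhds (div_pos T.width_pos hM))
  filter_upwards [this, self_mem_nhdsWithin] with h hh (h0 : 0 < h)
  rw [lt_div_iff₀ hM] at hh
  exact ⟨contDiff_const.mul hg, fun x hx => mul_pos h0 (hpos x hx), fun x hx =>
    (mul_le_mul_of_nonneg_left (hgM x hx) h0.le).trans_lt hh⟩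

/-- The entries of `D(W₀)` vanish on `S`, hence are `O(|t|) = O(h)` in the shell, like those of `h
D(W₁)`. Squaring and multiplying by the volume `O(h)` gives the cube. -/
theorem exists_symL2Sq_le (T : TubularCoords Ω) (hΩ : Bornology.IsBounded Ω) {W₀ W₁ : Rn n → Rn n}
    (h₀ : ContDiff ℝ ∞ W₀) (h₁ : ContDiff ℝ ∞ W₁)
    (hsym : ∀ x ∈ frontier Ω, ∀ ξ, ⟪fderiv ℝ W₀ x ξ, ξ⟫ = 0)
    {g₁ g₂ : Rn n → ℝ} (hg₁ : ContDiff ℝ ∞ g₁) (hg₂ : ContDiff ℝ ∞ g₂) :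
    ∃ C > 0, ∀ᶠ h in 𝓝[>] (0 : ℝ),
      symL2Sq (shell Ω (fun x => h * g₁ x) (fun x => h * g₂ x))
        (jac fun z => W₀ z + h • W₁ z) ≤ C * h ^ 3 := by
  obtain ⟨M₁, hM₁, hgM₁⟩ := exists_pos_bound hΩ hg₁.continuous
  obtain ⟨M₂, hM₂, hgM₂⟩ := exists_pos_bound hΩ hg₂.continuous
  set M := max M₁ M₂ with hMdef
  have hM : 0 < M := lt_max_of_lt_left hM₁
  have hsm : ∀ {W : Rn n → Rn n}, ContDiff ℝ ∞ W → ∀ i j,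
      ContDiff ℝ ∞ fun z => symPart (jac W z) i j := fun hW i j => by
    simp only [symPart_apply]
    exact ((contDiff_jac hW i j).add (contDiff_jac hW j i)).div_const 2
  choose L hL0 hL using fun i j => T.exists_bound_of_eq_zero hΩ (hsm h₀ i j)
    fun x hx => symPart_jac_eq_zero (hsym x hx) i j
  choose B hB using fun i j => (T.isCompact_tube hΩ).exists_bound_of_continuousOn
    (hsm h₁ i j).continuous.continuousOn
  obtain ⟨V, hV, s₀, hs₀, hvol⟩ := T.exists_volume_thin_le hΩ
  set D := ∑ i, ∑ j, (L i j * M + B i j) ^ 2 with hD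
  have hD0 : 0 ≤ D := Finset.sum_nonneg fun _ _ => Finset.sum_nonneg fun _ _ => sq_nonneg _
  -- The added `1` only ensures a positive constant.
  refine ⟨D * (V * M) + 1, by positivity, ?_⟩
  have e1 : ∀ᶠ h in 𝓝[>] (0 : ℝ), h < T.width / M :=
    nhdsWithin_le_nhds (gt_mem_nhds (div_pos T.width_pos hM))
  have e2 : ∀ᶠ h in 𝓝[>] (0 : ℝ), h < s₀ / M :=
    nhdsWithin_le_nhds (gt_mem_nhds (div_pos hs₀ hM))
  filter_upwards [e1, e2, self_mem_nhdsWithin] with h hw hs (h0 : 0 < h)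
  rw [lt_div_iff₀ hM] at hw hs
  have hmem : ∀ z ∈ shell Ω (fun x => h * g₁ x) (fun x => h * g₂ x),
      ∃ x ∈ frontier Ω, ∃ t : ℝ, |t| < h * M ∧ z = x + t • T.normal x := by
    rintro _ ⟨x, hx, t, ht1, ht2, rfl⟩
    refine ⟨x, hx, t, ?_, by rw [T.normal_eq x hx]⟩
    have b1 := mul_le_mul_of_nonneg_left ((hgM₁ x hx).trans (le_max_left M₁ M₂)) h0.le
    have b2 := mul_le_mul_of_nonneg_left ((hgM₂ x hx).trans (le_max_right M₁ M₂)) h0.le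
    exact abs_lt.2 ⟨by linarith, by linarith⟩
  have hv := (measure_mono (μ := volume) fun z hz => hmem z hz).trans
    (hvol (h * M) (by positivity) hs)
  have hpt : ∀ z ∈ shell Ω (fun x => h * g₁ x) (fun x => h * g₂ x),
      ‖frobSq (symPart (jac (fun z => W₀ z + h • W₁ z) z))‖ ≤ D * h ^ 2 := by
    intro z hz
    obtain ⟨x, hx, t, ht, rfl⟩ := hmem z hz
    rw [Real.norm_of_nonneg (frobSq_nonneg _), hD, Finset.sum_mul, frobSq]
    refine Finset.sum_le_sum fun i _ => ?_
    rw [Finset.sum_mul]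
    refine Finset.sum_le_sum fun j _ => ?_
    set z := x + t • T.normal x
    have hlin : symPart (jac (fun z => W₀ z + h • W₁ z) z) i j =
        symPart (jac W₀ z) i j + h * symPart (jac W₁ z) i j := by
      rw [jac_add_smul h₀ h₁]
      simp only [symPart_apply, Matrix.add_apply, Matrix.smul_apply, smul_eq_mul]
      ring
    have q1 := hL i j x hx t (ht.le.trans hw.le)
    have q2 := hB i j z (T.mem_tube hx (ht.le.trans hw.le))
    rw [Real.norm_eq_abs] at q2
    rw [hlin, ← mul_pow, ← sq_abs]
    refine pow_le_pow_left₀ (abs_nonneg _) ?_ 2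
    calc _ ≤ |symPart (jac W₀ z) i j| + |h * symPart (jac W₁ z) i j| := abs_add_le _ _
      _ ≤ L i j * (h * M) + h * B i j := by
          rw [abs_mul, abs_of_pos h0]
          exact add_le_add (q1.trans (mul_le_mul_of_nonneg_left ht.le (hL0 i j)))
            (mul_le_mul_of_nonneg_left q2 h0.le)
      _ = _ := by ring
  have hI := norm_setIntegral_le_of_norm_le_const (hv.trans_lt ENNReal.ofReal_lt_top) hpt
  have hv' : volume.real (shell Ω (fun x => h * g₁ x) (fun x => h * g₂ x)) ≤ V * (h * M) :=
    ENNReal.toReal_le_of_le_ofReal (by positivity) hv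
  calc symL2Sq _ _ ≤ D * h ^ 2 * volume.real _ := (Real.le_norm_self _).trans hI
    _ ≤ D * h ^ 2 * (V * (h * M)) := mul_le_mul_of_nonneg_left hv' (by positivity)
    _ = D * (V * M) * h ^ 3 := by ring
    _ ≤ (D * (V * M) + 1) * h ^ 3 := by
        apply mul_le_mul_of_nonneg_right _ (by positivity); linarith

theorem eq_zero_of_single {L : Rn n →L[ℝ] Rn n}
    (h : ∀ j, L (EuclideanSpace.single j 1) = 0) : L = 0 := by
  ext1 w
  rw [← (EuclideanSpace.basisFun (Fin n) ℝ).sum_repr w, map_sum]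
  simp [h]

/-- A nonzero entry of `∇W₀` at one point of `S` stays away from zero nearby for all small `h`. The
layer `|t| < h m` over that spot lies in the shell and has volume at least a multiple of `h`. -/
theorem exists_le_l2Sq (T : TubularCoords Ω) (hΩ : Bornology.IsBounded Ω) {W₀ W₁ : Rn n → Rn n}
    (h₀ : ContDiff ℝ ∞ W₀) (h₁ : ContDiff ℝ ∞ W₁)
    (hne : ∃ x ∈ frontier Ω, fderiv ℝ W₀ x ≠ 0)
    {g₁ g₂ : Rn n → ℝ} (hg₁ : ContDiff ℝ ∞ g₁) (hg₂ : ContDiff ℝ ∞ g₂)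
    (hp₁ : ∀ x ∈ frontier Ω, 0 < g₁ x) (hp₂ : ∀ x ∈ frontier Ω, 0 < g₂ x) :
    ∃ c > 0, ∀ᶠ h in 𝓝[>] (0 : ℝ),
      c * h ≤ l2Sq (shell Ω (fun x => h * g₁ x) (fun x => h * g₂ x))
        (jac fun z => W₀ z + h • W₁ z) := by
  obtain ⟨x, hx, hne⟩ := hne
  obtain ⟨i, j, hij⟩ : ∃ i j, jac W₀ x i j ≠ 0 := by
    by_contra! hcon
    apply hne
    refine eq_zero_of_single fun j => ?_
    ext i
    exact hcon i j
  obtain ⟨m₁, hm₁, hgm₁⟩ := exists_pos_lower_bound hΩ hg₁.continuous hp₁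
  obtain ⟨m₂, hm₂, hgm₂⟩ := exists_pos_lower_bound hΩ hg₂.continuous hp₂
  set m := min m₁ m₂ with hmdef
  have hm : 0 < m := lt_min hm₁ hm₂
  set δ := (jac W₀ x i j) ^ 2 / 2 with hδ
  have hδ0 : 0 < δ := by positivity
  have hcont : Continuous fun p : ℝ × Rn n => (jac W₀ p.2 i j + p.1 * jac W₁ p.2 i j) ^ 2 := by
    have c0 := (contDiff_jac h₀ i j).continuous
    have c1 := (contDiff_jac h₁ i j).continuous
    fun_prop
  have hev : ∀ᶠ p : ℝ × Rn n in 𝓝 0 ×ˢ 𝓝 x,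
      δ < (jac W₀ p.2 i j + p.1 * jac W₁ p.2 i j) ^ 2 ∧ p.2 ∈ T.dom := by
    rw [← nhds_prod_eq]
    refine (hcont.continuousAt.eventually (lt_mem_nhds ?_)).and
      (continuous_snd.continuousAt.eventually (T.isOpen_dom.mem_nhds (T.mem_dom_self hx)))
    simp only [zero_mul, add_zero, hδ]
    exact half_lt_self (by positivity)
  obtain ⟨P, hP, Q, hQ, hPQ⟩ := eventually_prod_iff.1 hev
  obtain ⟨R, hR, hRQ⟩ := Metric.eventually_nhds_iff_ball.1 hQ
  have hd1 := T.fderiv_sdist_normal hx (t := 0) (by simpa using T.width_pos)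
  rw [zero_smul, add_zero] at hd1
  obtain ⟨s₀, hs₀, c, hc, hvol⟩ := le_volume_layer T.sdist_smooth (T.norm_normal x hx) hd1
    (T.sdist_self hx) hR
  refine ⟨δ * (c * m), by positivity, ?_⟩
  have e2 : ∀ᶠ h in 𝓝[>] (0 : ℝ), h < s₀ / m :=
    nhdsWithin_le_nhds (gt_mem_nhds (div_pos hs₀ hm))
  filter_upwards [e2, nhdsWithin_le_nhds hP, T.eventually_isThin hΩ hg₁ hp₁,
    T.eventually_isThin hΩ hg₂ hp₂, self_mem_nhdsWithin] with h hs hPh t₁ t₂ (h0 : 0 < h)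
  rw [lt_div_iff₀ hm] at hs
  set U := shell Ω (fun x => h * g₁ x) (fun x => h * g₂ x) with hU
  set A := Metric.ball x R ∩ {z | |T.sdist z| < h * m} with hA
  have hAU : A ⊆ U := by
    rintro z ⟨hz, hzs : |T.sdist z| < h * m⟩
    have hzd : z ∈ T.dom := (hPQ hPh (hRQ z hz)).2
    have hzs' := abs_lt.1 hzs
    rw [hU, shell_eq t₁ t₂]
    have b1 := mul_le_mul_of_nonneg_left
      ((min_le_left m₁ m₂).trans (hgm₁ _ (T.proj_mem z hzd))) h0.le
    have b2 := mul_le_mul_of_nonneg_left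
      ((min_le_right m₁ m₂).trans (hgm₂ _ (T.proj_mem z hzd))) h0.le
    exact ⟨hzd, by linarith, by linarith⟩
  have hAm : MeasurableSet A := (Metric.isOpen_ball.inter
    (isOpen_lt (continuous_abs.comp T.sdist_smooth.continuous) continuous_const)).measurableSet
  have hsm : ContDiff ℝ ∞ fun z => W₀ z + h • W₁ z := h₀.add (h₁.const_smul h)
  have hc : Continuous fun z => frobSq (jac (fun z => W₀ z + h • W₁ z) z) :=
    continuous_frobSq fun i j => (contDiff_jac hsm i j).continuous
  have hint : IntegrableOn (fun z => frobSq (jac (fun z => W₀ z + h • W₁ z) z)) U :=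
    integrableOn_of_continuous hc (T.isBounded_shell hΩ t₁ t₂)
  have hpt : ∀ z ∈ A, δ ≤ frobSq (jac (fun z => W₀ z + h • W₁ z) z) := by
    intro z hz
    rw [jac_add_smul h₀ h₁]
    refine (hPQ hPh (hRQ z hz.1)).1.le.trans ?_
    exact sq_apply_le_frobSq (jac W₀ z + h • jac W₁ z) i j
  calc δ * (c * m) * h = δ * (c * (h * m)) := by ring
    _ ≤ δ * volume.real A := mul_le_mul_of_nonneg_left (hvol _ (by positivity) hs) hδ0.le
    _ ≤ ∫ z in A, frobSq (jac (fun z => W₀ z + h • W₁ z) z) :=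
        setIntegral_ge_of_const_le_real hAm (measure_ne_top_of_subset inter_subset_left
          measure_ball_lt_top.ne) hpt (hint.mono_set hAU)
    _ ≤ l2Sq U _ := setIntegral_mono_set hint
        (Eventually.of_forall fun z => frobSq_nonneg _) hAU.eventuallyLE

end TubularCoords

/-! ### Tangent rigid motions of thin shells -/

namespace TubularCoords

variable {Ω : Set (Rn n)}

theorem fderiv_sdist_self (T : TubularCoords Ω) {x : Rn n} (hx : x ∈ frontier Ω) (ξ : Rn n) :
    fderiv ℝ T.sdist x ξ = ⟪ξ, T.normal x⟫ := by
  have h := congrArg (fun w => ⟪w, T.normal x⟫) (T.fderiv_recon (T.mem_dom_self hx) ξ)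
  have h0 := T.inner_fderiv_proj x (T.mem_dom_self hx) ξ
  rw [T.proj_self hx] at h0
  simpa [T.sdist_self hx, T.proj_self hx, inner_add_left, real_inner_smul_left, h0,
    T.norm_normal x hx] using h

/-- Without rotational symmetry, a rigid motion tangent to the hypersurface is trivial. -/
theorem rigid_eq_zero (T : TubularCoords Ω) (hS : (frontier Ω).Nonempty)
    (hrot : NoRotationalSymmetry Ω) {A : Rn n →L[ℝ] Rn n} {b : Rn n}
    (hA : ∀ z, ⟪A z, z⟫ = 0) (ht : ∀ x ∈ frontier Ω, ⟪A x + b, T.normal x⟫ = 0) :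
    A = 0 ∧ b = 0 := by
  have h0 : ∀ x ∈ frontier Ω, A x + b = 0 := hrot (fun z => A z + b)
    ⟨⟨A, b, hA, fun _ => rfl⟩, fun x hx => by rw [← T.normal_eq x hx]; exact ht x hx⟩
  obtain ⟨x, hx⟩ := hS
  have hskew : ∀ ξ η, ⟪A ξ, η⟫ = -⟪ξ, A η⟫ := fun ξ η => by
    have h := hA (ξ + η)
    rw [map_add, inner_add_left, inner_add_right, inner_add_right, hA, hA] at h
    rw [real_inner_comm (A η) ξ]
    linarith
  have hτ : ∀ τ, ⟪τ, T.normal x⟫ = 0 → A τ = 0 := fun τ hτ => by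
    have h := T.fderiv_eq_zero_of_const h0 hx (A.differentiableAt.add_const b) hτ
    rwa [fderiv_add_const, A.fderiv] at h
  -- By skewness `A n` is tangent, so `A (A n) = 0` and `|A n|² = -⟨n, A (A n)⟩ = 0`.
  have hN : A (T.normal x) = 0 := by
    have h := hskew (T.normal x) (A (T.normal x))
    rw [hτ (A (T.normal x)) (hA _), inner_zero_right, neg_zero] at h
    exact inner_self_eq_zero.1 h
  have hA0 : A = 0 := by
    ext1 ξ
    have h := hτ (ξ - ⟪ξ, T.normal x⟫ • T.normal x) (by
      rw [inner_sub_left, real_inner_smul_left, real_inner_self_eq_norm_sq, T.norm_normal x hx]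
      ring)
    rwa [map_sub, map_smul, hN, smul_zero, sub_zero] at h
  refine ⟨hA0, ?_⟩
  have h := h0 x hx
  rwa [hA0, zero_apply, zero_add] at h

/-- Tangency at the upper boundary is linear in `(A, b)` and continuous in `h`; at `h = 0` it is
tangency to `S`, violated somewhere by each nonzero skew pair. Compactness of the unit sphere makes
the violation uniform for small `h`. -/
theorem eventually_rigid_eq_zero (T : TubularCoords Ω) (hΩ : Bornology.IsBounded Ω)
    (hS : (frontier Ω).Nonempty) (hrot : NoRotationalSymmetry Ω) {g₁ g₂ : Rn n → ℝ}
    (hg₁ : ContDiff ℝ ∞ g₁) (hg₂ : ContDiff ℝ ∞ g₂)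
    (hp₁ : ∀ x ∈ frontier Ω, 0 < g₁ x) (hp₂ : ∀ x ∈ frontier Ω, 0 < g₂ x) :
    ∀ᶠ h in 𝓝[>] (0 : ℝ), ∀ w,
      IsTangentRigid (shell Ω (fun x => h * g₁ x) (fun x => h * g₂ x)) w → ∀ z, w z = 0 := by
  let pt : ℝ → Rn n → Rn n := fun h x => x + (h * g₂ x) • T.normal x
  let F : ℝ → (Rn n →L[ℝ] Rn n) × Rn n → Rn n → ℝ := fun h p x =>
    fderiv ℝ T.sdist (pt h x) (p.1 (pt h x) + p.2) -
      h * fderiv ℝ g₂ x (fderiv ℝ T.proj (pt h x) (p.1 (pt h x) + p.2))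
  have hFc : ∀ x, Continuous fun q : ℝ × ((Rn n →L[ℝ] Rn n) × Rn n) => F q.1 q.2 x := by
    intro x
    have c1 : Continuous fun q : ℝ × ((Rn n →L[ℝ] Rn n) × Rn n) => pt q.1 x := by
      simp only [pt]; fun_prop
    have c2 : Continuous fun q : ℝ × ((Rn n →L[ℝ] Rn n) × Rn n) => q.2.1 (pt q.1 x) + q.2.2 :=
      ((continuous_fst.comp continuous_snd).clm_apply c1).add
        (continuous_snd.comp continuous_snd)
    have c3 := ((T.sdist_smooth.continuous_fderiv (by simp)).comp c1).clm_apply c2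
    have c4 := ((T.proj_smooth.continuous_fderiv (by simp)).comp c1).clm_apply c2
    exact c3.sub (continuous_fst.mul ((fderiv ℝ g₂ x).continuous.comp c4))
  let K : Set ((Rn n →L[ℝ] Rn n) × Rn n) :=
    Metric.sphere 0 1 ∩ {p | ∀ z, ⟪p.1 z, z⟫ = 0}
  have hK : IsCompact K := by
    refine (isCompact_sphere _ _).inter_right ?_
    simp only [ofPred_forall]
    refine isClosed_iInter fun z => isClosed_eq ?_ continuous_const
    exact (continuous_fst.clm_apply continuous_const).inner continuous_const
  have key : ∀ᶠ h in 𝓝 (0 : ℝ), ∀ p ∈ K, ∃ x ∈ frontier Ω, F h p x ≠ 0 := by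
    refine hK.eventually_forall_of_forall_eventually fun p hp => ?_
    have : ∃ x ∈ frontier Ω, F 0 p x ≠ 0 := by
      by_contra! hcon
      obtain ⟨hA0, hb0⟩ := T.rigid_eq_zero hS hrot hp.2 fun x hx => by
        have h := hcon x hx
        simp only [F, pt, zero_mul, zero_smul, add_zero, sub_zero, T.fderiv_sdist_self hx] at h
        exact h
      have h1 : ‖p‖ = 1 := mem_sphere_zero_iff_norm.1 hp.1
      rw [show p = 0 from Prod.ext hA0 hb0, norm_zero] at h1
      exact zero_ne_one h1
    obtain ⟨x, hx, hne⟩ := this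
    filter_upwards [(hFc x).continuousAt.eventually_ne (x := (0, p)) hne] with q hq
    exact ⟨x, hx, hq⟩
  filter_upwards [nhdsWithin_le_nhds key, T.eventually_isThin hΩ hg₁ hp₁,
    T.eventually_isThin hΩ hg₂ hp₂] with h hkey t₁ t₂
  rintro w ⟨⟨A, b, hA, hw⟩, ht⟩
  have hF0 : ∀ x ∈ frontier Ω, F h (A, b) x = 0 := by
    intro x hx
    have hmem : x + (h * g₂ x) • T.normal x ∈
        frontier (shell Ω (fun x => h * g₁ x) (fun x => h * g₂ x)) := by
      rw [frontier_shell hΩ t₁ t₂]; exact Or.inr ⟨x, hx, rfl⟩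
    have h1 := (inner_outerNormal_upper hΩ t₁ t₂ hx _).1 (ht _ hmem)
    rw [hw, fderiv_const_mul (hg₂.differentiable (by simp) x)] at h1
    simpa [F, pt] using h1
  have hzero : ((A, b) : (Rn n →L[ℝ] Rn n) × Rn n) = 0 := by
    by_contra hne
    have hpos : 0 < ‖((A, b) : (Rn n →L[ℝ] Rn n) × Rn n)‖ := norm_pos_iff.2 hne
    -- Homogeneity of `F` transfers the result from unit pairs to arbitrary ones.
    set c := ‖((A, b) : (Rn n →L[ℝ] Rn n) × Rn n)‖⁻¹ with hc
    obtain ⟨x, hx, hFx⟩ := hkey (c • (A, b)) ⟨by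
      rw [mem_sphere_zero_iff_norm, norm_smul, hc, norm_inv, norm_norm,
        inv_mul_cancel₀ hpos.ne'], fun z => by
      simp [real_inner_smul_left, hA]⟩
    apply hFx
    have hs : F h (c • (A, b)) x = c * F h (A, b) x := by
      simp only [F, Prod.smul_fst, Prod.smul_snd, smul_apply, ← smul_add, map_smul, smul_eq_mul]
      ring
    rw [hs, hF0 x hx, mul_zero]
  intro z
  rw [hw, (Prod.mk_eq_zero.1 hzero).1, (Prod.mk_eq_zero.1 hzero).2]
  simp

end TubularCoords

/-! ### Korn constants -/

theorem div_le_of_sqrt_le {C c h K a b : ℝ} (hC : 0 < C) (hc : 0 < c) (hh : 0 < h)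
    (hK : √a ≤ K * √b) (ha : c * h ≤ a) (hb : b ≤ C * h ^ 3) : √(c / C) / h ≤ K := by
  have ha0 : 0 < √a := Real.sqrt_pos.2 (lt_of_lt_of_le (by positivity) ha)
  -- `K` has no assumed sign; positivity of the left side forces it, so the inequality may be
  -- squared.
  have hK0 : 0 < K := by
    by_contra! hneg
    exact absurd (hK.trans (mul_nonpos_of_nonpos_of_nonneg hneg (Real.sqrt_nonneg b)))
      (not_le.2 ha0)
  have h1 : √(c * h) ≤ K * √(C * h ^ 3) :=
    (Real.sqrt_le_sqrt ha).trans (hK.trans (by gcongr))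
  have h2 : c * h ≤ K ^ 2 * (C * h ^ 3) := by
    have := pow_le_pow_left₀ (Real.sqrt_nonneg _) h1 2
    rwa [mul_pow, Real.sq_sqrt (by positivity), Real.sq_sqrt (by positivity)] at this
  rw [div_le_iff₀ hh]
  apply Real.sqrt_le_iff.2 ⟨by positivity, ?_⟩
  rw [div_le_iff₀ hC]
  have : c * h ≤ (K * h) ^ 2 * C * h := by linarith
  exact le_of_mul_le_mul_right this hh

theorem l2Sq_le_w12Sq (U : Set (Rn n)) (u : Rn n → Rn n)
    (G : Rn n → Matrix (Fin n) (Fin n) ℝ) : l2Sq U G ≤ w12Sq U u G :=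
  le_add_of_nonneg_left (integral_nonneg fun _ => sq_nonneg _)

/-! ### Assembly of the estimates -/

theorem mainTheorem4 {n : ℕ} (Ω : Set (Rn n)) (hΩ : HasSmoothBoundary Ω)
    (hΩb : Bornology.IsBounded Ω)
    (g₁ g₂ : Rn n → ℝ) (hg₁ : IsSmoothOn (frontier Ω) g₁) (hg₂ : IsSmoothOn (frontier Ω) g₂)
    (hg₁pos : ∀ x ∈ frontier Ω, 0 < g₁ x) (hg₂pos : ∀ x ∈ frontier Ω, 0 < g₂ x)
    (v : Rn n → Rn n) (hv : IsKilling Ω v) (hv0 : ∃ x ∈ frontier Ω, v x ≠ 0)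
    (hvg : ∀ x ∈ frontier Ω, ⟪v x, surfGrad Ω (fun y => g₁ y + g₂ y) x⟫ = 0) :
    ∃ h₀ > (0 : ℝ), ∃ C > (0 : ℝ), ∃ c > (0 : ℝ), ∃ κ > (0 : ℝ), ∀ h : ℝ, 0 < h → h < h₀ →
      -- the shell is a smooth domain with boundary the two graphs over `S`
      HasSmoothBoundary (shell Ω (fun x => h * g₁ x) (fun x => h * g₂ x)) ∧
      frontier (shell Ω (fun x => h * g₁ x) (fun x => h * g₂ x)) =
        (fun x => x - (h * g₁ x) • outerNormal Ω x) '' frontier Ω ∪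
        (fun x => x + (h * g₂ x) • outerNormal Ω x) '' frontier Ω ∧
      -- the extension is well defined by its formula, on the closed shell
      (∀ x ∈ frontier Ω, ∀ t : ℝ, -(h * g₁ x) ≤ t → t ≤ h * g₂ x →
        killingExt Ω g₁ g₂ v h (x + t • outerNormal Ω x) = extValue Ω g₂ v h x t) ∧
      -- tangency on the boundary of the shell
      (∀ z ∈ frontier (shell Ω (fun x => h * g₁ x) (fun x => h * g₂ x)),
        ⟪killingExt Ω g₁ g₂ v h z,
          outerNormal (shell Ω (fun x => h * g₁ x) (fun x => h * g₂ x)) z⟫ = 0) ∧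
      -- the extension is of class `W^{1,2}`, with the two bounds
      (∃ G, HasW12Grad (shell Ω (fun x => h * g₁ x) (fun x => h * g₂ x))
          (killingExt Ω g₁ g₂ v h) G ∧
        HasZeroNormalTrace (shell Ω (fun x => h * g₁ x) (fun x => h * g₂ x))
          (killingExt Ω g₁ g₂ v h) G ∧
        symL2Sq (shell Ω (fun x => h * g₁ x) (fun x => h * g₂ x)) G ≤ C * h ^ 3 ∧
        c * h ≤ l2Sq (shell Ω (fun x => h * g₁ x) (fun x => h * g₂ x)) G) ∧
      -- blow-up of the Korn constants
      (∀ K : ℝ, IsKornConst (shell Ω (fun x => h * g₁ x) (fun x => h * g₂ x)) K → κ / h ≤ K) ∧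
      (NoRotationalSymmetry Ω → ∀ K : ℝ,
        IsKornConstModRigid (shell Ω (fun x => h * g₁ x) (fun x => h * g₂ x)) K → κ / h ≤ K) := by
  obtain ⟨T⟩ := exists_tubularCoords hΩ hΩb
  obtain ⟨G₁, hG₁, eG₁⟩ := hg₁
  obtain ⟨G₂, hG₂, eG₂⟩ := hg₂
  obtain ⟨⟨V, hV, eV⟩, hvt, hvk⟩ := hv
  have hp₁ : ∀ x ∈ frontier Ω, 0 < G₁ x := fun x hx => by rw [← eG₁ hx]; exact hg₁pos x hx
  have hp₂ : ∀ x ∈ frontier Ω, 0 < G₂ x := fun x hx => by rw [← eG₂ hx]; exact hg₂pos x hx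
  have hVt : ∀ x ∈ frontier Ω, ⟪V x, T.normal x⟫ = 0 := fun x hx => by
    rw [← eV hx]; exact (T.isTangent_iff hx).1 (hvt x hx)
  have hVk : ∀ x ∈ frontier Ω, ∀ τ, ⟪τ, T.normal x⟫ = 0 → ⟪fderiv ℝ V x τ, τ⟫ = 0 := by
    intro x hx τ hτ
    rw [← T.fderivWithin_eq eV hx (hV.differentiable (by simp) x) hτ]
    exact hvk x hx τ ((T.isTangent_iff hx).2 hτ)
  have hV0 : ∃ x ∈ frontier Ω, V x ≠ 0 := by
    obtain ⟨x, hx, h⟩ := hv0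
    exact ⟨x, hx, by rwa [← eV hx]⟩
  have hS : (frontier Ω).Nonempty := by
    obtain ⟨x, hx, -⟩ := hv0
    exact ⟨x, hx⟩
  have hVg : ∀ x ∈ frontier Ω, fderiv ℝ G₁ x (V x) + fderiv ℝ G₂ x (V x) = 0 := by
    intro x hx
    have d₁ := hG₁.differentiable (by simp) x
    have d₂ := hG₂.differentiable (by simp) x
    have h := hvg x hx
    rw [real_inner_comm, eV hx, T.inner_surfGrad (g' := fun y => G₁ y + G₂ y)
      (fun y hy => by simp only [eG₁ hy, eG₂ hy]) hx (d₁.add d₂) (hVt x hx),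
      fderiv_fun_add d₁ d₂] at h
    simpa using h
  have hE₀ := T.contDiff_extMain hV
  have hE₁ := T.contDiff_extCorr hG₂ hV
  obtain ⟨C, hC, hupper⟩ := T.exists_symL2Sq_le hΩb hE₀ hE₁
    (fun x hx ξ => T.inner_fderiv_extMain hV hVt hVk hx ξ) hG₁ hG₂
  obtain ⟨c, hc, hlower⟩ := T.exists_le_l2Sq hΩb hE₀ hE₁
    (T.exists_fderiv_extMain_ne_zero hΩb hV hVt hV0) hG₁ hG₂ hp₁ hp₂
  -- The symmetry hypothesis stays inside the eventuality, so a single `h₀` serves whether or not it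
  -- holds.
  have hrigid : ∀ᶠ h in 𝓝[>] (0 : ℝ), NoRotationalSymmetry Ω → ∀ w,
      IsTangentRigid (shell Ω (fun x => h * G₁ x) (fun x => h * G₂ x)) w → ∀ z, w z = 0 := by
    by_cases hrot : NoRotationalSymmetry Ω
    · filter_upwards [T.eventually_rigid_eq_zero hΩb hS hrot hG₁ hG₂ hp₁ hp₂] with h hh _ using hh
    · exact Eventually.of_forall fun h hrot' => absurd hrot' hrot
  obtain ⟨h₀, hh₀, hall⟩ := (mem_nhdsGT_iff_exists_Ioo_subset (a := (0 : ℝ))).1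
    (hupper.and (hlower.and (hrigid.and ((T.eventually_isThin hΩb hG₁ hp₁).and
      (T.eventually_isThin hΩb hG₂ hp₂)))))
  -- The value `√(c / C)` comes from `c h ≤ K² C h³`.
  refine ⟨h₀, hh₀, C, hC, c, hc, √(c / C), Real.sqrt_pos.2 (div_pos hc hC), fun h h0 hlt => ?_⟩
  obtain ⟨hup, hlo, hrig, t₁, t₂⟩ := hall ⟨h0, hlt⟩
  have e₁ : EqOn (fun x => h * g₁ x) (fun x => h * G₁ x) (frontier Ω) := fun x hx => by
    simp only [eG₁ hx]
  have e₂ : EqOn (fun x => h * g₂ x) (fun x => h * G₂ x) (frontier Ω) := fun x hx => by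
    simp only [eG₂ hx]
  rw [shell_congr e₁ e₂]
  set U := shell Ω (fun x => h * G₁ x) (fun x => h * G₂ x) with hU
  set W : Rn n → Rn n := fun z => T.extMain V z + h • T.extCorr G₂ V z with hW
  have hWs : ContDiff ℝ ∞ W := hE₀.add (hE₁.const_smul h)
  have hext : ∀ x ∈ frontier Ω, ∀ t : ℝ, -(h * G₁ x) ≤ t → t ≤ h * G₂ x →
      killingExt Ω g₁ g₂ v h (x + t • outerNormal Ω x) = extValue Ω g₂ v h x t := by
    intro x hx t h1 h2
    rw [killingExt, TubularCoords.normalCoord_eq t₁ t₂ e₁ e₂ hx h1 h2]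
  have hextW : ∀ z ∈ closure U, killingExt Ω g₁ g₂ v h z = W z := by
    intro z hz
    obtain ⟨x, hx, t, h1, h2, rfl⟩ := TubularCoords.exists_of_mem_closure_shell hΩb t₁ t₂ hz
    rw [T.normal_eq x hx, hext x hx t h1 h2, TubularCoords.extValue_eq hG₂ eG₂ eV hVt h hx
      (TubularCoords.abs_lt_width t₁ t₂ hx h1 h2).le, ← T.normal_eq x hx]
  have htan : ∀ z ∈ frontier U, ⟪W z, outerNormal U z⟫ = 0 := by
    intro z hz
    rw [TubularCoords.frontier_shell hΩb t₁ t₂] at hz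
    rcases hz with ⟨x, hx, rfl⟩ | ⟨x, hx, rfl⟩
    · refine (TubularCoords.inner_outerNormal_lower hΩb t₁ t₂ hx _).2 ?_
      obtain ⟨q1, q2⟩ := TubularCoords.fderiv_proj_extValue (T := T) hVt (G := G₂) h hx
        (t₁.abs_neg_lt hx)
      rw [hW]
      simp only [q1, q2, fderiv_const_mul (hG₁.differentiable (by simp) x), smul_apply,
        smul_eq_mul]
      -- The lower graph is the only place where `∂_v(g₁ + g₂) = 0` enters; the upper condition
      -- holds identically.
      linear_combination -h * hVg x hx
    · refine (TubularCoords.inner_outerNormal_upper hΩb t₁ t₂ hx _).2 ?_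
      obtain ⟨q1, q2⟩ := TubularCoords.fderiv_proj_extValue (T := T) hVt (G := G₂) h hx
        (t₂.abs_lt hx)
      rw [hW]
      simp only [q1, q2, fderiv_const_mul (hG₂.differentiable (by simp) x), smul_apply,
        smul_eq_mul, sub_self]
  have hUm : MeasurableSet U := (TubularCoords.isOpen_shell t₁ t₂).measurableSet
  have hUb : Bornology.IsBounded U := T.isBounded_shell hΩb t₁ t₂
  have heq : EqOn (killingExt Ω g₁ g₂ v h) W U := fun z hz => hextW z (subset_closure hz)
  have hgrad := hasW12Grad_of_eqOn hUm hUb hWs heq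
  have htrace := hasZeroNormalTrace_of_eqOn hUm hWs heq htan
  have hw12 := hlo.trans (l2Sq_le_w12Sq U (killingExt Ω g₁ g₂ v h) (jac W))
  refine ⟨TubularCoords.hasSmoothBoundary_shell hΩb t₁ t₂, ?_, ?_, ?_,
    ⟨jac W, hgrad, htrace, hup, hlo⟩, ?_, ?_⟩
  · rw [TubularCoords.frontier_shell hΩb t₁ t₂]
    congr 1
    · exact image_congr fun x hx => by
        rw [eG₁ hx, T.normal_eq x hx, neg_smul, sub_eq_add_neg]
    · exact image_congr fun x hx => by rw [eG₂ hx, T.normal_eq x hx]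
  · intro x hx t h1 h2
    exact hext x hx t (by rwa [← eG₁ hx]) (by rwa [← eG₂ hx])
  · intro z hz
    rw [hextW z (frontier_subset_closure hz)]
    exact htan z hz
  · intro K hK
    exact div_le_of_sqrt_le hC hc h0 (hK _ _ hgrad htrace) hw12 hup
  · intro hrot K hK
    refine div_le_of_sqrt_le hC hc h0 (hK _ _ hgrad htrace fun w hw => ?_) hw12 hup
    -- Every admissible rigid motion is zero, so orthogonality is automatic.
    simp [hrig hrot w hw]
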